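/- Let $1\le p\le\infty$, $d\ge 2$, $1<\kappa\le 2$, $L,R,\varepsilon>0$, and let $\|\cdot\|_p$ be the $p$-norm on $\mathbb R^d$ with dual norm $\|\cdot\|_{p_*}$. Let $\mathcal F$ be the class of convex differentiable functions $f:\mathbb R^d\to\mathbb R$ that are $(L,\kappa)$-weakly smooth, i.e. $\|\nabla f(x)-\nabla f(y)\|_{p_*}\le L\|x-y\|_p^{\kappa-1}$ for all $x,y$, and whose minimum is attained at some point of the ball $\{x:\|x\|_p\le R\}$. An oracle $\mathcal O:\mathcal F\times\mathbb R^d\to V$ (with an arbitrary answer set $V$) is called local if $\mathcal O(f,x)=\mathcal O(g,x)$ whenever $f,g\in\mathcal F$ coincide on some ball of positive radius around $x$. A method $\mathcal A$ consists of a starting point $x^0$ and maps $\mathcal A_{k+1}$ that produce $x^{k+1}=\mathcal A_{k+1}(x^0,\mathcal O(f,x^0),\dots,x^k,\mathcal O(f,x^k))$, for all $k\ge 0$. Put $T(\mathcal A,f,\varepsilon)=\inf\{k\ge 0:\|\nabla f(x^k)\|_{p_*}\le\varepsilon\}$ and $\mathrm{Compl}(\mathcal F,\mathcal O,\varepsilon)=\inf_{\mathcal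 A}\sup_{f\in\mathcal F}T(\mathcal A,f,\varepsilon)$. There is an absolute constant $c>0$, independent of $p,d,\kappa,L,R,\varepsilon$ and $\mathcal O$, such that for every local oracle $\mathcal O$, with $$N=\begin{cases} c\,\Big(\dfrac{LR^{\kappa-1}}{\varepsilon\,[\ln d]^{\kappa-1}}\Big)^{\frac{2}{3\kappa-2}} & \text{if } 1\le p<2,\\[2ex] \Big(c\,\dfrac{LR^{\kappa-1}}{\varepsilon\,\min\{p,\ln d\}^{\kappa-1}}\Big)^{\frac{p}{\kappa p+\kappa-p}} & \text{if } 2\le p<\infty,\\[2ex] \Big(c\,\dfrac{LR^{\kappa-1}}{\varepsilon\,[\ln d]^{\kappa-1}}\Big)^{\frac{1}{\kappa-1}} & \text{if } p=\infty,\end{cases}$$ one has $\mathrm{Compl}(\mathcal F,\mathcal O,\varepsilon)\ge N$ whenever $1\le N\le d$. -/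

import Mathlib

open scoped ENNReal

noncomputable section

namespace OracleComplexity

section Model

variable {E : Type*} [NormedAddCommGroup E] [NormedSpace ℝ E]

/-- `f` is `(L, κ)`-weakly smooth: it is differentiable and its gradient is `(κ - 1)`-Hölder
continuous with constant `L`. The gradient is the functional `fderiv ℝ f x` on `E`, and its
operator norm is the norm dual to that of `E`. -/
def WeaklySmooth (L κ : ℝ) (f : E → ℝ) : Prop :=
  Differentiable ℝ f ∧ ∀ x y : E, ‖fderiv ℝ f x - fderiv ℝ f y‖ ≤ L * ‖x - y‖ ^ (κ - 1)

/-- The convex `(L, κ)`-weakly smooth functions on `E` whose minimum is attained in the closed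
ball of radius `R` about the origin. -/
def problemClass (E : Type*) [NormedAddCommGroup E] [NormedSpace ℝ E] (L κ R : ℝ) :
    Set (E → ℝ) :=
  {f | ConvexOn ℝ Set.univ f ∧ WeaklySmooth L κ f ∧
    ∃ xs ∈ Metric.closedBall (0 : E) R, ∀ y, f xs ≤ f y}

/-- An oracle `O` for the class `C` is local if its answer at `x` is the same for any two
functions of the class that coincide on some ball about `x`. -/
def IsLocalOracle {V : Type*} (C : Set (E → ℝ)) (O : C → E → V) : Prop :=
  ∀ (f g : C) (x : E),
    (∃ r : ℝ, 0 < r ∧ ∀ y ∈ Metric.closedBall x r, f.1 y = g.1 y) → O f x = O g x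

/-- A (deterministic, adaptive) method: its `k`-th map chooses the `k`-th query point from the
list of the `k` previous query points and oracle answers. The map with index `0` has no data
and is the starting point. -/
abbrev Method (E V : Type*) := (k : ℕ) → (Fin k → E × V) → E

/-- The query points of the method `A` when queries are answered by `ans`. -/
def queryPoint {E V : Type*} (A : Method E V) (ans : E → V) (k : ℕ) : E :=
  A k (fun i => (queryPoint A ans i.1, ans (queryPoint A ans i.1)))
termination_by k
decreasing_by all_goals exact i.2

/-- The least `k` for which the gradient at the `k`-th query point (counted from `0`) has dual
norm at most `ε`; it is `⊤` if there is no such `k`. -/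
def gradientTime {V : Type*} (A : Method E V) (ans : E → V) (f : E → ℝ) (ε : ℝ) : ℕ∞ :=
  ⨅ (k : ℕ) (_ : ‖fderiv ℝ f (queryPoint A ans k)‖ ≤ ε), (k : ℕ∞)

/-- The worst-case oracle complexity of making the dual norm of the gradient at most `ε`, for
the class `C` with oracle `O`. -/
def gradientComplexity {V : Type*} (C : Set (E → ℝ)) (O : C → E → V) (ε : ℝ) : ℕ∞ :=
  ⨅ A : Method E V, ⨆ f : C, gradientTime A (O f) f.1 ε

end Model

/-- `ℝ^d` with the `p`-norm. -/
abbrev EllP (p : ℝ≥0∞) (d : ℕ) := PiLp p (fun _ : Fin d => ℝ)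

/-- The rate for `1 ≤ p < 2`, with constant `c`. -/
def rateBelowTwo (c : ℝ) (d : ℕ) (L κ R ε : ℝ) : ℝ :=
  c * (L * R ^ (κ - 1) / (ε * Real.log d ^ (κ - 1))) ^ (2 / (3 * κ - 2))

/-- The rate for finite `p ≥ 2`, with constant `c`. -/
def rateFinite (c p : ℝ) (d : ℕ) (L κ R ε : ℝ) : ℝ :=
  (c * (L * R ^ (κ - 1) / (ε * (min p (Real.log d)) ^ (κ - 1)))) ^ (p / (κ * p + κ - p))

/-- The rate for `p = ∞`, with constant `c`. -/
def rateInfinite (c : ℝ) (d : ℕ) (L κ R ε : ℝ) : ℝ :=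
  (c * (L * R ^ (κ - 1) / (ε * Real.log d ^ (κ - 1)))) ^ (1 / (κ - 1))

end OracleComplexity

end

/-!
The lower bound comes from a resisting oracle acting on smoothed maxima of linear functions.

Let `M = ⌈N⌉` and let `T` be a linear map from `ℝ^d` with the `p`-norm to `ℝ^M` with the `2m`-norm.
For a permutation `σ` and signs `ξ`, the function `hardMax δ σ ξ` on `ℝ^M` is the maximum of the
constant `-Mδ` and of the `M` functions `ξ s * y (σ s) - s δ`. At its `s`-th query `y` the method is
answered as if `σ s` were the coordinate of largest modulus among those not yet used and `ξ s` its
sign. Then the `s`-th function dominates all later ones, and the constant, on the ball of radius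
`δ / 2` about `y`, so that a local answer reveals nothing about the later choices
(`exists_greedy_choices`, `hardMax_congr`). Since the constant is not active there, the maximum drops
at unit rate in the direction `-ξ` (`hardMax_sub_smul_le`), and the gradient is at least `1 / W` in the
dual norm if each vector of signs has a preimage under `T` of norm at most `W`. This holds at all
of the first `M` queries. The minimum is the constant `-Mδ`, and it is attained at a preimage of
`-Mδ ξ`, whose norm is at most `MδW`.

To be weakly smooth the maximum is replaced by its infimal convolution with `a‖·‖²`, `a = 4 / δ`,
which depends only on the values at distance at most `1 / a`. As the square of the `2m`-norm has
second differences of order `m` (`norm_add_sq_add_norm_sub_sq_le`), so has the infimal convolution,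
and a convex function with this property has a Lipschitz gradient; interpolation with the
Lipschitz constant of the function gives the Hölder condition
(`weaklySmooth_of_second_difference_le`). Balancing the parameters yields `le_gradientComplexity`.

For `p ≥ 2` the map `T` is the projection onto `M` coordinates, so that `W = M ^ (1 / p)`, and `2m` is
of the order of `min p (log d)`: either `2m ≥ p`, or the `2m`-norm is equivalent to the maximum norm.
For `p < 2` the map `T` consists of `M` rows of the Hartley transform, a multiple of an orthogonal
matrix with entries of modulus at most `2`, so that `W = √M` as in the Euclidean case, and `m` is of
the order of `log d`.
Both matrices exist for all `M ≤ d`, which is why the bound holds for all `N ≤ d`.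
-/

noncomputable section

namespace OracleComplexity

/-! ### Smoothness of convex functions from second differences -/

section ConvexCalculus

variable {E : Type*} [NormedAddCommGroup E] [NormedSpace ℝ E]

/-- Subgradients come from separating a point of the graph from the strict epigraph. -/
theorem exists_subgradient {f : E → ℝ} (hf : ConvexOn ℝ Set.univ f) (hc : Continuous f) (x : E) :
    ∃ g : E →L[ℝ] ℝ, ∀ y, f x + g (y - x) ≤ f y := by
  have hconv : Convex ℝ {q : E × ℝ | q.1 ∈ Set.univ ∧ f q.1 < q.2} := hf.convex_strict_epigraph
  have hopen : IsOpen {q : E × ℝ | q.1 ∈ Set.univ ∧ f q.1 < q.2} := by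
    simp only [Set.mem_univ, true_and]
    exact isOpen_lt (hc.comp continuous_fst) continuous_snd
  obtain ⟨φ, hφ⟩ := geometric_hahn_banach_open_point hconv hopen (x := (x, f x)) (by simp)
  set b : ℝ := φ (0, 1) with hb
  set l : E →L[ℝ] ℝ := φ.comp (ContinuousLinearMap.inl ℝ E ℝ) with hl
  have hsplit : ∀ y s, φ (y, s) = l y + s * b := by
    intro y s
    have : ((y, s) : E × ℝ) = (y, 0) + s • (0, 1) := by simp
    rw [this, map_add, map_smul]
    simp [hl, hb]
  have hlt : ∀ y s, f y < s → l y + s * b < l x + f x * b := by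
    intro y s h
    rw [← hsplit, ← hsplit]
    exact hφ (y, s) ⟨trivial, h⟩
  have hbneg : b < 0 := by
    have := hlt x (f x + 1) (by linarith)
    linarith
  refine ⟨(-b⁻¹) • l, fun y => ?_⟩
  refine le_of_forall_pos_le_add fun e he => ?_
  have h := hlt y (f y + e) (by linarith)
  have h2 : l (y - x) < (f x - f y - e) * b := by rw [map_sub]; linarith
  have h3 : (-b⁻¹) * l (y - x) < (-b⁻¹) * ((f x - f y - e) * b) :=
    mul_lt_mul_of_pos_left h2 (by have := inv_neg''.2 hbneg; linarith)
  have h4 : (-b⁻¹) * ((f x - f y - e) * b) = f y + e - f x := by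
    have hb1 : b⁻¹ * b = 1 := inv_mul_cancel₀ hbneg.ne
    linear_combination (f y + e - f x) * hb1
  simp only [smul_apply, smul_eq_mul]
  linarith

/-- A convex function with second symmetric differences at most `A‖h‖²` is differentiable: any
subgradient is a derivative, with a quadratic error term. -/
theorem hasFDerivAt_of_second_difference_le {f : E → ℝ} (hf : ConvexOn ℝ Set.univ f)
    (hc : Continuous f) {A : ℝ}
    (hA : ∀ x h, f (x + h) + f (x - h) ≤ 2 * f x + A * ‖h‖ ^ 2) (x : E) :
    ∃ g : E →L[ℝ] ℝ, HasFDerivAt f g x ∧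
      ∀ h, f x + g h ≤ f (x + h) ∧ f (x + h) ≤ f x + g h + A * ‖h‖ ^ 2 := by
  obtain ⟨g, hg⟩ := exists_subgradient hf hc x
  have key : ∀ h, f x + g h ≤ f (x + h) ∧ f (x + h) ≤ f x + g h + A * ‖h‖ ^ 2 := by
    intro h
    have h1 := hg (x + h)
    have h2 := hg (x - h)
    have h3 := hA x h
    rw [add_sub_cancel_left] at h1
    rw [sub_sub_cancel_left, map_neg] at h2
    exact ⟨h1, by linarith⟩
  refine ⟨g, ?_, key⟩
  rw [hasFDerivAt_iff_isLittleO_nhds_zero]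
  refine Asymptotics.IsBigO.trans_isLittleO (g := fun h : E => ‖h‖ ^ 2) ?_ ?_
  · refine Asymptotics.IsBigO.of_bound A (Filter.Eventually.of_forall fun h => ?_)
    obtain ⟨h1, h2⟩ := key h
    rw [Real.norm_of_nonneg (by linarith), Real.norm_of_nonneg (by positivity)]
    linarith
  · have := Asymptotics.isLittleO_norm_pow_id (E' := E) one_lt_two
    exact this

theorem norm_fderiv_sub_le_of_second_difference_le {f : E → ℝ} (hf : ConvexOn ℝ Set.univ f)
    (hc : Continuous f) {A : ℝ} (hA0 : 0 ≤ A)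
    (hA : ∀ x h, f (x + h) + f (x - h) ≤ 2 * f x + A * ‖h‖ ^ 2) (x y : E) :
    ‖fderiv ℝ f x - fderiv ℝ f y‖ ≤ 4 * A * ‖x - y‖ := by
  obtain ⟨gx, hgx, hx⟩ := hasFDerivAt_of_second_difference_le hf hc hA x
  obtain ⟨gy, hgy, hy⟩ := hasFDerivAt_of_second_difference_le hf hc hA y
  rw [hgx.fderiv, hgy.fderiv]
  rcases eq_or_ne x y with rfl | hxy
  · rw [hgx.unique hgy]; simp
  have hpos : 0 < ‖x - y‖ := norm_pos_iff.2 (sub_ne_zero.2 hxy)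
  -- Comparing the two expansions at `x + h` bounds the gradient difference on vectors of
  -- length `‖x - y‖`, which is enough by homogeneity.
  have key : ∀ h, ‖h‖ = ‖x - y‖ → (gx - gy) h ≤ 4 * A * ‖x - y‖ ^ 2 := by
    intro h hh
    have h1 := (hx h).1
    have h2 := (hy (x - y + h)).2
    have h3 := (hy (x - y)).1
    have h4 : ‖x - y + h‖ ^ 2 ≤ (2 * ‖x - y‖) ^ 2 := by
      gcongr
      calc _ ≤ ‖x - y‖ + ‖h‖ := norm_add_le _ _
        _ = _ := by rw [hh]; ring
    have e : y + (x - y + h) = x + h := by abel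
    rw [e, map_add] at h2
    rw [add_sub_cancel] at h3
    have h5 := mul_le_mul_of_nonneg_left h4 hA0
    simp only [sub_apply]
    nlinarith
  have key2 : ∀ h, (gx - gy) h ≤ 4 * A * ‖x - y‖ * ‖h‖ := by
    intro h
    rcases eq_or_ne h 0 with rfl | hne
    · simp
    have hh : 0 < ‖h‖ := norm_pos_iff.2 hne
    have := key ((‖x - y‖ / ‖h‖) • h) (by
      rw [norm_smul, Real.norm_of_nonneg (by positivity)]; field_simp)
    rw [map_smul, smul_eq_mul, div_mul_eq_mul_div, div_le_iff₀ hh] at this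
    have h2 : ‖x - y‖ * (gx - gy) h ≤ ‖x - y‖ * (4 * A * ‖x - y‖ * ‖h‖) := by
      linarith
    exact le_of_mul_le_mul_left h2 hpos
  refine ContinuousLinearMap.opNorm_le_bound _ (by positivity) fun h => ?_
  rw [Real.norm_eq_abs, abs_le]
  refine ⟨?_, key2 h⟩
  have := key2 (-h)
  rw [map_neg, norm_neg] at this
  linarith

/-- Interpolation between the bound `2B` on the oscillation of the gradient of a `B`-Lipschitz
function and the Lipschitz bound on the gradient gives Hölder bounds of every exponent. -/
theorem weaklySmooth_of_second_difference_le {f : E → ℝ} (hf : ConvexOn ℝ Set.univ f)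
    {B D κ : ℝ} (hB : 0 < B) (hD : 0 ≤ D) (hκ1 : 1 < κ) (hκ2 : κ ≤ 2)
    (hLip : ∀ x y, f x - f y ≤ B * ‖x - y‖)
    (hA : ∀ x h, f (x + h) + f (x - h) ≤ 2 * f x + B * D * ‖h‖ ^ 2) :
    WeaklySmooth (2 * B * (2 * D) ^ (κ - 1)) κ f := by
  have hL : LipschitzWith B.toNNReal f := by
    refine LipschitzWith.of_le_add_mul _ fun x y => ?_
    have := hLip x y
    rw [dist_eq_norm, Real.coe_toNNReal _ hB.le]
    linarith
  have hc := hL.continuous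
  refine ⟨fun x => ?_, fun x y => ?_⟩
  · obtain ⟨g, hg, -⟩ := hasFDerivAt_of_second_difference_le hf hc hA x
    exact hg.differentiableAt
  have h1 := norm_fderiv_sub_le_of_second_difference_le hf hc (by positivity) hA x y
  have h2 : ‖fderiv ℝ f x - fderiv ℝ f y‖ ≤ 2 * B := by
    have hb := fun z => norm_fderiv_le_of_lipschitz (𝕜 := ℝ) (x₀ := z) hL
    simp only [Real.coe_toNNReal _ hB.le] at hb
    linarith [norm_sub_le (fderiv ℝ f x) (fderiv ℝ f y), hb x, hb y]
  set n := ‖fderiv ℝ f x - fderiv ℝ f y‖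
  set s := n / (2 * B) with hs
  have hs0 : 0 ≤ s := by positivity
  have hs1 : s ≤ 1 := by rw [hs, div_le_one (by positivity)]; exact h2
  have hs2 : s ≤ 2 * D * ‖x - y‖ := by
    rw [hs, div_le_iff₀ (by positivity)]; linarith
  have h3 : s ≤ (2 * D * ‖x - y‖) ^ (κ - 1) :=
    calc s = s ^ (1 : ℝ) := (Real.rpow_one s).symm
      _ ≤ s ^ (κ - 1) :=
        Real.rpow_le_rpow_of_exponent_ge_of_imp hs0 hs1 (by linarith) (by intros; linarith)
      _ ≤ _ := Real.rpow_le_rpow hs0 hs2 (by linarith)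
  rw [Real.mul_rpow (by positivity) (norm_nonneg _)] at h3
  have hn : n = 2 * B * s := by rw [hs]; field_simp
  rw [hn, mul_assoc (2 * B)]
  gcongr

end ConvexCalculus

/-! ### Infimal convolution with the squared norm -/

section InfConvolution

variable {Y : Type*} [NormedAddCommGroup Y]

/-- The infimal convolution of `h` with `a‖·‖²`. -/
def quadInfConv (a : ℝ) (h : Y → ℝ) (y : Y) : ℝ := ⨅ v, (h (y - v) + a * ‖v‖ ^ 2)

variable {a c : ℝ} {h : Y → ℝ}

theorem quadInfConv_le (ha : 0 < a) (hc : ∀ u, c ≤ h u) (y v : Y) :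
    quadInfConv a h y ≤ h (y - v) + a * ‖v‖ ^ 2 := by
  refine ciInf_le ⟨c, ?_⟩ v
  rintro _ ⟨u, rfl⟩
  have : 0 ≤ a * ‖u‖ ^ 2 := by positivity
  linarith [hc (y - u)]

theorem le_quadInfConv {b : ℝ} {y : Y} (hb : ∀ v, b ≤ h (y - v) + a * ‖v‖ ^ 2) :
    b ≤ quadInfConv a h y := le_ciInf hb

theorem quadInfConv_lower_bound (ha : 0 < a) (hc : ∀ u, c ≤ h u) (y : Y) :
    c ≤ quadInfConv a h y :=
  le_quadInfConv fun v => by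
    have : 0 ≤ a * ‖v‖ ^ 2 := by positivity
    linarith [hc (y - v)]

/-- For a `1`-Lipschitz function only the ball of radius `1 / a` matters for the infimum. -/
theorem le_quadInfConv_of_ball (ha : 0 < a) (hL : ∀ u v, h u - h v ≤ ‖u - v‖) {b : ℝ} {y : Y}
    (hb : ∀ v, ‖v‖ ≤ 1 / a → b ≤ h (y - v) + a * ‖v‖ ^ 2) : b ≤ quadInfConv a h y := by
  refine le_quadInfConv fun v => ?_
  rcases le_or_gt ‖v‖ (1 / a) with hv | hv
  · exact hb v hv
  have h0 := hb 0 (by simp; positivity)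
  have h1 := hL y (y - v)
  simp only [sub_zero, norm_zero, sub_sub_cancel] at h0 h1
  have h2 : ‖v‖ * 1 ≤ ‖v‖ * (a * ‖v‖) := by
    gcongr
    rw [div_lt_iff₀ ha] at hv
    linarith
  nlinarith

theorem quadInfConv_congr (ha : 0 < a) (hc : ∀ u, c ≤ h u) {k : Y → ℝ} (hck : ∀ u, c ≤ k u)
    (hL : ∀ u v, h u - h v ≤ ‖u - v‖) (hLk : ∀ u v, k u - k v ≤ ‖u - v‖) {y : Y}
    (hhk : ∀ u, ‖u - y‖ ≤ 1 / a → h u = k u) : quadInfConv a h y = quadInfConv a k y := by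
  have e : ∀ v, ‖v‖ ≤ 1 / a → h (y - v) = k (y - v) := fun v hv => hhk _ (by simpa using hv)
  refine le_antisymm (le_quadInfConv_of_ball ha hLk fun v hv => ?_)
    (le_quadInfConv_of_ball ha hL fun v hv => ?_)
  · rw [← e v hv]; exact quadInfConv_le ha hc y v
  · rw [e v hv]; exact quadInfConv_le ha hck y v

theorem quadInfConv_sub_le (ha : 0 < a) (hc : ∀ u, c ≤ h u) (hL : ∀ u v, h u - h v ≤ ‖u - v‖)
    (x y : Y) : quadInfConv a h x - quadInfConv a h y ≤ ‖x - y‖ := by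
  suffices quadInfConv a h x - ‖x - y‖ ≤ quadInfConv a h y by linarith
  refine le_quadInfConv fun v => ?_
  have h1 := quadInfConv_le ha hc x v
  have h2 := hL (x - v) (y - v)
  rw [sub_sub_sub_cancel_right] at h2
  linarith

/-- Along a direction in which `h` drops at unit rate on the ball of radius `1 / a`, the infimal
convolution drops at unit rate, too. -/
theorem quadInfConv_sub_le_sub (ha : 0 < a) (hc : ∀ u, c ≤ h u)
    (hL : ∀ u v, h u - h v ≤ ‖u - v‖) {y z : Y} {t : ℝ}
    (hz : ∀ u, ‖u - y‖ ≤ 1 / a → h (u - z) ≤ h u - t) :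
    quadInfConv a h (y - z) ≤ quadInfConv a h y - t := by
  suffices quadInfConv a h (y - z) + t ≤ quadInfConv a h y by linarith
  refine le_quadInfConv_of_ball ha hL fun v hv => ?_
  have h1 := quadInfConv_le ha hc (y - z) v
  have h2 := hz (y - v) (by simpa using hv)
  rw [sub_right_comm] at h1
  linarith

theorem quadInfConv_second_difference_le (ha : 0 < a) (hc : ∀ u, c ≤ h u) {K : ℝ}
    (hK : ∀ u v : Y, ‖u + v‖ ^ 2 + ‖u - v‖ ^ 2 ≤ 2 * ‖u‖ ^ 2 + 2 * K * ‖v‖ ^ 2) (y z : Y) :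
    quadInfConv a h (y + z) + quadInfConv a h (y - z) ≤
      2 * quadInfConv a h y + 2 * a * K * ‖z‖ ^ 2 := by
  suffices (quadInfConv a h (y + z) + quadInfConv a h (y - z) - 2 * a * K * ‖z‖ ^ 2) / 2 ≤
      quadInfConv a h y by linarith
  refine le_quadInfConv fun v => ?_
  have h1 := quadInfConv_le ha hc (y + z) (v + z)
  have h2 := quadInfConv_le ha hc (y - z) (v - z)
  have h3 := mul_le_mul_of_nonneg_left (hK v z) ha.le
  rw [add_sub_add_right_eq_sub] at h1
  rw [sub_sub_sub_cancel_right] at h2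
  linarith

theorem convexOn_quadInfConv [NormedSpace ℝ Y] (ha : 0 < a) (hc : ∀ u, c ≤ h u)
    (hh : ConvexOn ℝ Set.univ h) :
    ConvexOn ℝ Set.univ (quadInfConv a h) := by
  refine ⟨convex_univ, fun x _ y _ s t hs ht hst => ?_⟩
  have hsq : ConvexOn ℝ Set.univ (fun v : Y => ‖v‖ ^ 2) :=
    (convexOn_norm convex_univ).pow (fun _ _ => norm_nonneg _) 2
  have key : ∀ u v, quadInfConv a h (s • x + t • y) ≤
      s * (h (x - u) + a * ‖u‖ ^ 2) + t * (h (y - v) + a * ‖v‖ ^ 2) := by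
    intro u v
    have h1 := quadInfConv_le ha hc (s • x + t • y) (s • u + t • v)
    have h2 := hh.2 (Set.mem_univ (x - u)) (Set.mem_univ (y - v)) hs ht hst
    have h3 := hsq.2 (Set.mem_univ u) (Set.mem_univ v) hs ht hst
    have e : s • (x - u) + t • (y - v) = s • x + t • y - (s • u + t • v) := by
      rw [smul_sub, smul_sub]; abel
    rw [e] at h2
    simp only [smul_eq_mul] at h2 h3
    nlinarith
  simp only [smul_eq_mul]
  have step : ∀ u, quadInfConv a h (s • x + t • y) ≤
      s * (h (x - u) + a * ‖u‖ ^ 2) + t * quadInfConv a h y := by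
    intro u
    rw [quadInfConv.eq_def a h y, Real.mul_iInf_of_nonneg ht]
    suffices quadInfConv a h (s • x + t • y) - s * (h (x - u) + a * ‖u‖ ^ 2) ≤
        ⨅ v, t * (h (y - v) + a * ‖v‖ ^ 2) by linarith
    exact le_ciInf fun v => by linarith [key u v]
  rw [quadInfConv.eq_def a h x, Real.mul_iInf_of_nonneg hs]
  suffices quadInfConv a h (s • x + t • y) - t * quadInfConv a h y ≤
      ⨅ v, s * (h (x - v) + a * ‖v‖ ^ 2) by linarith
  exact le_ciInf fun u => by linarith [step u]

end InfConvolution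

/-! ### The resisting oracle -/

section ResistingOracle

theorem queryPoint_congr {E W : Type*} (A : Method E W) {ans ans' : E → W} (k : ℕ)
    (h : ∀ j < k, ans (queryPoint A ans j) = ans' (queryPoint A ans j)) :
    queryPoint A ans k = queryPoint A ans' k := by
  induction k using Nat.strong_induction_on with
  | _ k ih =>
    rw [queryPoint, queryPoint]
    congr 1
    funext i
    have e := ih i.1 i.2 fun j hj => h j (hj.trans i.2)
    rw [← e, h i.1 i.2]

variable {M : ℕ}

/-- Among the coordinates `σ s, σ (s + 1), …`, the coordinate `σ s` of `z` has the largest modulus,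
and `ξ s` is a sign of it. -/
def IsGreedyAt (σ : Equiv.Perm (Fin M)) (ξ : Fin M → ℤˣ) (s : Fin M) (z : Fin M → ℝ) : Prop :=
  (∀ s', s ≤ s' → |z (σ s')| ≤ |z (σ s)|) ∧ ((ξ s : ℤ) : ℝ) * z (σ s) = |z (σ s)|

/-- If the answer at a point where the `s`-th choice is greedy depends only on the choices up to
`s`, then the choices can be made so that each of them is greedy at the corresponding query. -/
theorem exists_greedy_choices {E W : Type*} (A : Method E W)
    (ans : Equiv.Perm (Fin M) → (Fin M → ℤˣ) → E → W) (z : E → Fin M → ℝ)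
    (hloc : ∀ (s : Fin M) (x : E) (σ σ' : Equiv.Perm (Fin M)) (ξ ξ' : Fin M → ℤˣ),
      (∀ s' ≤ s, σ s' = σ' s' ∧ ξ s' = ξ' s') → IsGreedyAt σ ξ s (z x) →
      IsGreedyAt σ' ξ' s (z x) → ans σ ξ x = ans σ' ξ' x) :
    ∃ (σ : Equiv.Perm (Fin M)) (ξ : Fin M → ℤˣ),
      ∀ s : Fin M, IsGreedyAt σ ξ s (z (queryPoint A (ans σ ξ) s)) := by
  suffices H : ∀ t ≤ M, ∃ (σ : Equiv.Perm (Fin M)) (ξ : Fin M → ℤˣ),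
      ∀ s : Fin M, s.1 < t → IsGreedyAt σ ξ s (z (queryPoint A (ans σ ξ) s)) by
    obtain ⟨σ, ξ, h⟩ := H M le_rfl
    exact ⟨σ, ξ, fun s => h s s.2⟩
  intro t
  induction t with
  | zero => exact fun _ => ⟨1, 1, fun s hs => absurd hs (Nat.not_lt_zero _)⟩
  | succ t ih =>
    intro ht
    obtain ⟨σ, ξ, h⟩ := ih (by omega)
    set i : Fin M := ⟨t, ht⟩ with hi
    set x := queryPoint A (ans σ ξ) t with hx
    obtain ⟨m, hm, hmax⟩ := (Finset.Ici i).exists_max_image (fun s => |z x (σ s)|)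
      ⟨i, Finset.mem_Ici.2 le_rfl⟩
    rw [Finset.mem_Ici] at hm
    set σ' : Equiv.Perm (Fin M) := (Equiv.swap i m).trans σ with hσ'
    set ξ' : Fin M → ℤˣ := Function.update ξ i (if 0 ≤ z x (σ m) then 1 else -1) with hξ'
    -- The swap permutes the positions from `i` on, so it keeps the earlier choices greedy.
    have hswap : ∀ s s' : Fin M, s ≤ i → s ≤ s' → s ≤ Equiv.swap i m s' := by
      intro s s' hs hs'
      rw [Equiv.swap_apply_def]
      split_ifs
      exacts [hs.trans hm, hs, hs']
    have hagree : ∀ s < i, σ s = σ' s ∧ ξ s = ξ' s := by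
      intro s hs
      refine ⟨?_, ?_⟩
      · rw [hσ', Equiv.trans_apply, Equiv.swap_apply_of_ne_of_ne hs.ne (hs.trans_le hm).ne]
      · rw [hξ', Function.update_of_ne hs.ne]
    have hgreedy : ∀ s < i, IsGreedyAt σ' ξ' s (z (queryPoint A (ans σ ξ) s)) := by
      intro s hs
      obtain ⟨h1, h2⟩ := h s hs
      obtain ⟨e1, e2⟩ := hagree s hs
      refine ⟨fun s' hs' => ?_, by rw [← e1, ← e2]; exact h2⟩
      rw [← e1]
      exact h1 _ (hswap s s' hs.le hs')
    have hans : ∀ s < i, ans σ ξ (queryPoint A (ans σ ξ) s) =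
        ans σ' ξ' (queryPoint A (ans σ ξ) s) := fun s hs =>
      hloc s _ σ σ' ξ ξ' (fun s' hs' => hagree s' (hs'.trans_lt hs)) (h s hs) (hgreedy s hs)
    have hq : ∀ s ≤ t, queryPoint A (ans σ ξ) s = queryPoint A (ans σ' ξ') s := fun s hs =>
      queryPoint_congr A s fun j hj => hans ⟨j, by omega⟩ (Fin.mk_lt_mk.2 (by omega))
    refine ⟨σ', ξ', fun s hs => ?_⟩
    rw [← hq s (by omega)]
    rcases (Nat.lt_succ_iff_lt_or_eq.1 hs) with hs | hs
    · exact hgreedy s hs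
    · obtain rfl : s = i := Fin.ext hs
      change IsGreedyAt σ' ξ' i (z x)
      have e1 : σ' i = σ m := by rw [hσ', Equiv.trans_apply, Equiv.swap_apply_left]
      refine ⟨fun s' hs' => ?_, ?_⟩
      · rw [e1]
        exact hmax _ (Finset.mem_Ici.2 (hswap i s' le_rfl hs'))
      · rw [e1, hξ', Function.update_self]
        split_ifs with h0
        · simp [abs_of_nonneg h0]
        · simp [abs_of_neg (not_le.1 h0)]

end ResistingOracle

/-! ### The maximum of signed coordinates -/

section HardFunction

variable {M : ℕ} {r : ℝ≥0∞}

/-- The maximum of the constant `-Mδ` and of the functions `ξ s * y (σ s) - s δ`, `s < M`. -/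
def hardMax (δ : ℝ) (σ : Equiv.Perm (Fin M)) (ξ : Fin M → ℤˣ) (y : EllP r M) : ℝ :=
  Finset.univ.fold max (-(M * δ)) fun s : Fin M => ((ξ s : ℤ) : ℝ) * y (σ s) - s * δ

variable {δ : ℝ} {σ σ' : Equiv.Perm (Fin M)} {ξ ξ' : Fin M → ℤˣ}

theorem hardMax_le_iff {y : EllP r M} {b : ℝ} : hardMax δ σ ξ y ≤ b ↔
    -(M * δ) ≤ b ∧ ∀ s : Fin M, ((ξ s : ℤ) : ℝ) * y (σ s) - s * δ ≤ b := by
  simp [hardMax, Finset.fold_max_le]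

theorem neg_mul_le_hardMax (y : EllP r M) : -(M * δ) ≤ hardMax δ σ ξ y :=
  (hardMax_le_iff.1 le_rfl).1

theorem le_hardMax (y : EllP r M) (s : Fin M) :
    ((ξ s : ℤ) : ℝ) * y (σ s) - s * δ ≤ hardMax δ σ ξ y :=
  (hardMax_le_iff.1 le_rfl).2 s

theorem convexOn_hardMax : ConvexOn ℝ Set.univ (hardMax (r := r) δ σ ξ) := by
  refine ⟨convex_univ, fun x _ y _ s t hs ht hst => ?_⟩
  simp only [smul_eq_mul]
  have hc : ∀ b : ℝ, b = s * b + t * b := fun b => by rw [← add_mul, hst, one_mul]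
  rw [hardMax_le_iff]
  refine ⟨?_, fun i => ?_⟩
  · have h1 := mul_le_mul_of_nonneg_left (neg_mul_le_hardMax (δ := δ) (σ := σ) (ξ := ξ) x) hs
    have h2 := mul_le_mul_of_nonneg_left (neg_mul_le_hardMax (δ := δ) (σ := σ) (ξ := ξ) y) ht
    linarith [hc (-(M * δ))]
  · have h1 := mul_le_mul_of_nonneg_left (le_hardMax (δ := δ) (σ := σ) (ξ := ξ) x i) hs
    have h2 := mul_le_mul_of_nonneg_left (le_hardMax (δ := δ) (σ := σ) (ξ := ξ) y i) ht
    have h3 := hc (i * δ)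
    simp only [PiLp.add_apply, PiLp.smul_apply, smul_eq_mul]
    linarith

theorem abs_intCast_unit (u : ℤˣ) : |((u : ℤ) : ℝ)| = 1 := by
  rcases Int.units_eq_one_or u with rfl | rfl <;> simp

variable [Fact (1 ≤ r)]

theorem unit_mul_sub_le (u : ℤˣ) (y y' : EllP r M) (i : Fin M) :
    ((u : ℤ) : ℝ) * y i - ((u : ℤ) : ℝ) * y' i ≤ ‖y - y'‖ :=
  calc _ ≤ |((u : ℤ) : ℝ) * y i - ((u : ℤ) : ℝ) * y' i| := le_abs_self _
    _ = ‖(y - y') i‖ := by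
      rw [← mul_sub, abs_mul, abs_intCast_unit, one_mul, PiLp.sub_apply, Real.norm_eq_abs]
    _ ≤ ‖y - y'‖ := PiLp.norm_apply_le _ _

theorem hardMax_sub_le (y y' : EllP r M) : hardMax δ σ ξ y - hardMax δ σ ξ y' ≤ ‖y - y'‖ := by
  rw [sub_le_iff_le_add', hardMax_le_iff]
  refine ⟨?_, fun s => ?_⟩
  · linarith [neg_mul_le_hardMax (δ := δ) (σ := σ) (ξ := ξ) y', norm_nonneg (y - y')]
  · linarith [le_hardMax (δ := δ) (σ := σ) (ξ := ξ) y' s, unit_mul_sub_le (ξ s) y y' (σ s)]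

/-- At distance at most `δ / 2` from a point where the `s`-th choice is greedy, the `s`-th function
lies above all later ones and, by a margin, above the constant. -/
theorem IsGreedyAt.bounds {s : Fin M} {y u : EllP r M} (hg : IsGreedyAt σ ξ s y) (hδ : 0 < δ)
    (hu : ‖u - y‖ ≤ δ / 2) :
    -(M * δ) + δ / 2 ≤ ((ξ s : ℤ) : ℝ) * u (σ s) - s * δ ∧
      ∀ s', s < s' →
        ((ξ s' : ℤ) : ℝ) * u (σ s') - s' * δ ≤ ((ξ s : ℤ) : ℝ) * u (σ s) - s * δ := by
  have h1 := unit_mul_sub_le (ξ s) y u (σ s)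
  rw [norm_sub_rev, hg.2] at h1
  have hs : ((s : ℕ) : ℝ) + 1 ≤ M := by exact_mod_cast s.2
  refine ⟨?_, fun s' hs' => ?_⟩
  · nlinarith [abs_nonneg (y (σ s))]
  · have h2 := unit_mul_sub_le (ξ s') u y (σ s')
    have h3 : ((ξ s' : ℤ) : ℝ) * y (σ s') ≤ |y (σ s')| :=
      (le_abs_self _).trans_eq (by rw [abs_mul, abs_intCast_unit, one_mul])
    have h4 := hg.1 s' hs'.le
    have h5 : ((s : ℕ) : ℝ) + 1 ≤ (s' : ℕ) := by exact_mod_cast hs'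
    nlinarith

theorem IsGreedyAt.hardMax_le_iff {s : Fin M} {y u : EllP r M} (hg : IsGreedyAt σ ξ s y)
    (hδ : 0 < δ) (hu : ‖u - y‖ ≤ δ / 2) {b : ℝ} :
    hardMax δ σ ξ u ≤ b ↔ ∀ s' ≤ s, ((ξ s' : ℤ) : ℝ) * u (σ s') - s' * δ ≤ b := by
  rw [OracleComplexity.hardMax_le_iff]
  obtain ⟨h1, h2⟩ := hg.bounds hδ hu
  refine ⟨fun h s' _ => h.2 s', fun h => ⟨?_, fun s' => ?_⟩⟩
  · linarith [h s le_rfl]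
  · rcases le_or_gt s' s with hs | hs
    · exact h s' hs
    · exact (h2 s' hs).trans (h s le_rfl)

theorem hardMax_congr {s : Fin M} {y u : EllP r M}
    (hagree : ∀ s' ≤ s, σ s' = σ' s' ∧ ξ s' = ξ' s') (hg : IsGreedyAt σ ξ s y)
    (hg' : IsGreedyAt σ' ξ' s y) (hδ : 0 < δ) (hu : ‖u - y‖ ≤ δ / 2) :
    hardMax δ σ ξ u = hardMax δ σ' ξ' u := by
  refine eq_of_forall_ge_iff fun b => ?_
  rw [hg.hardMax_le_iff hδ hu, hg'.hardMax_le_iff hδ hu]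
  refine forall₂_congr fun s' hs' => ?_
  rw [(hagree s' hs').1, (hagree s' hs').2]

/-- Near a point where some choice is greedy the constant is inactive, so that the maximum drops at
unit rate in the direction of the vector of negated signs. -/
theorem hardMax_sub_smul_le {s : Fin M} {y u w : EllP r M} (hg : IsGreedyAt σ ξ s y)
    (hw : ∀ s', w (σ s') = ((ξ s' : ℤ) : ℝ)) (hu : ‖u - y‖ ≤ δ / 2) {t : ℝ} (ht : 0 < t)
    (htδ : t ≤ δ / 2) :
    hardMax δ σ ξ (u - t • w) ≤ hardMax δ σ ξ u - t := by
  rw [hardMax_le_iff]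
  refine ⟨?_, fun s' => ?_⟩
  · linarith [(hg.bounds (by linarith) hu).1, le_hardMax (δ := δ) (σ := σ) (ξ := ξ) u s]
  · have h1 := le_hardMax (δ := δ) (σ := σ) (ξ := ξ) u s'
    have h2 : ((ξ s' : ℤ) : ℝ) * ((ξ s' : ℤ) : ℝ) = 1 := by
      rw [← abs_mul_abs_self, abs_intCast_unit, one_mul]
    simp only [PiLp.sub_apply, PiLp.smul_apply, smul_eq_mul, hw]
    linear_combination h1 - t * h2

end HardFunction

/-! ### The lower bound for a general linear map -/

section LowerBound

variable {E : Type*} [NormedAddCommGroup E] [NormedSpace ℝ E] {M : ℕ} {r : ℝ≥0∞}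

variable {T : E →L[ℝ] EllP r M} {a lam B K W : ℝ}

theorem exists_signed_preimage
    (hW : ∀ η : Fin M → ℤˣ, ∃ w : E, ‖w‖ ≤ W ∧ ∀ i, T w i = ((η i : ℤ) : ℝ))
    (σ : Equiv.Perm (Fin M)) (ξ : Fin M → ℤˣ) :
    ∃ w : E, ‖w‖ ≤ W ∧ ∀ s, T w (σ s) = ((ξ s : ℤ) : ℝ) := by
  obtain ⟨w, hw, h⟩ := hW fun i => ξ (σ.symm i)
  exact ⟨w, hw, fun s => by rw [h, Equiv.symm_apply_apply]⟩

variable [Fact (1 ≤ r)]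

/-- The hard function: `hardMax`, smoothed by infimal convolution with `a‖·‖²`, scaled by `lam`, and
transported to `E` by the linear map `T`. The parameter `δ = 4 / a` of `hardMax` is such that the
values of the hard function on a neighbourhood of `x` depend only on those of `hardMax` at distance
at most `2 / a = δ / 2` from `T x`. -/
def hardFunction (T : E →L[ℝ] EllP r M) (a lam : ℝ) (σ : Equiv.Perm (Fin M)) (ξ : Fin M → ℤˣ)
    (x : E) : ℝ :=
  lam * quadInfConv a (hardMax (4 / a) σ ξ) (T x)

theorem convexOn_hardFunction (ha : 0 < a) (hlam : 0 < lam) (σ : Equiv.Perm (Fin M))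
    (ξ : Fin M → ℤˣ) : ConvexOn ℝ Set.univ (hardFunction T a lam σ ξ) := by
  refine ⟨convex_univ, fun x _ y _ s t hs ht hst => ?_⟩
  have h0 : ConvexOn ℝ Set.univ (quadInfConv a (hardMax (r := r) (4 / a) σ ξ)) :=
    convexOn_quadInfConv ha (neg_mul_le_hardMax (δ := 4 / a) (σ := σ) (ξ := ξ))
      (convexOn_hardMax (δ := 4 / a) (σ := σ) (ξ := ξ))
  have h := h0.2 (Set.mem_univ (T x)) (Set.mem_univ (T y)) hs ht hst
  have e : T (s • x + t • y) = s • T x + t • T y := by rw [map_add, map_smul, map_smul]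
  rw [← e, smul_eq_mul, smul_eq_mul] at h
  have h2 := mul_le_mul_of_nonneg_left h hlam.le
  rw [smul_eq_mul, smul_eq_mul]
  unfold hardFunction
  linarith

theorem hardFunction_mem_problemClass
    (hK : ∀ u v : EllP r M, ‖u + v‖ ^ 2 + ‖u - v‖ ^ 2 ≤ 2 * ‖u‖ ^ 2 + 2 * K * ‖v‖ ^ 2)
    (hT : ∀ x, ‖T x‖ ≤ B * ‖x‖)
    (hW : ∀ η : Fin M → ℤˣ, ∃ w : E, ‖w‖ ≤ W ∧ ∀ i, T w i = ((η i : ℤ) : ℝ))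
    {κ : ℝ} (hκ1 : 1 < κ) (hκ2 : κ ≤ 2) (hB : 0 < B) (hK0 : 0 < K) (ha : 0 < a) (hlam : 0 < lam)
    (σ : Equiv.Perm (Fin M)) (ξ : Fin M → ℤˣ) :
    hardFunction T a lam σ ξ ∈
      problemClass E (2 * (lam * B) * (2 * (2 * a * K * B)) ^ (κ - 1)) κ (4 * M * W / a) := by
  refine ⟨convexOn_hardFunction ha hlam σ ξ, ?_, ?_⟩
  · refine weaklySmooth_of_second_difference_le (convexOn_hardFunction ha hlam σ ξ)
      (by positivity) (by positivity) hκ1 hκ2 (fun x y => ?_) (fun x z => ?_)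
    · have h1 := quadInfConv_sub_le ha (neg_mul_le_hardMax (δ := 4 / a) (σ := σ) (ξ := ξ))
        hardMax_sub_le (T x) (T y)
      have h2 := hT (x - y)
      rw [map_sub] at h2
      have h3 := mul_le_mul_of_nonneg_left (h1.trans h2) hlam.le
      simp only [hardFunction]
      linarith
    · have h1 := quadInfConv_second_difference_le ha
        (neg_mul_le_hardMax (δ := 4 / a) (σ := σ) (ξ := ξ)) hK (T x) (T z)
      have h2 : ‖T z‖ ^ 2 ≤ (B * ‖z‖) ^ 2 := by gcongr; exact hT z
      have h3 : 2 * a * K * ‖T z‖ ^ 2 ≤ 2 * a * K * (B * ‖z‖) ^ 2 := by gcongr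
      have h4 := mul_le_mul_of_nonneg_left (h1.trans (add_le_add_right h3 _)) hlam.le
      simp only [hardFunction, map_add, map_sub]
      linarith
  · obtain ⟨w, hw, h⟩ := exists_signed_preimage hW σ ξ
    refine ⟨-((M * (4 / a)) • w), ?_, fun y => ?_⟩
    · rw [mem_closedBall_zero_iff, norm_neg, norm_smul, Real.norm_of_nonneg (by positivity)]
      calc _ ≤ M * (4 / a) * W := by gcongr
        _ = _ := by ring
    · refine mul_le_mul_of_nonneg_left (le_trans ?_
        (quadInfConv_lower_bound ha (neg_mul_le_hardMax (δ := 4 / a) (σ := σ) (ξ := ξ)) _)) hlam.le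
      have h1 := quadInfConv_le ha (neg_mul_le_hardMax (δ := 4 / a) (σ := σ) (ξ := ξ))
        (T (-((M * (4 / a)) • w))) 0
      refine h1.trans ?_
      simp only [sub_zero, norm_zero, ne_eq, OfNat.ofNat_ne_zero, not_false_eq_true, zero_pow,
        mul_zero, add_zero]
      rw [hardMax_le_iff]
      refine ⟨le_rfl, fun s => ?_⟩
      have h2 : ((ξ s : ℤ) : ℝ) * ((ξ s : ℤ) : ℝ) = 1 := by
        rw [← abs_mul_abs_self, abs_intCast_unit, one_mul]
      have h3 : 0 ≤ (s : ℝ) * (4 / a) := by positivity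
      simp only [map_neg, map_smul, PiLp.neg_apply, PiLp.smul_apply, smul_eq_mul, h]
      linear_combination h3 - M * (4 / a) * h2

/-- At a point where some choice is greedy, the hard function drops at rate `lam` along a direction
of norm at most `W`. -/
theorem le_norm_fderiv_hardFunction
    (hW : ∀ η : Fin M → ℤˣ, ∃ w : E, ‖w‖ ≤ W ∧ ∀ i, T w i = ((η i : ℤ) : ℝ))
    (ha : 0 < a) (hlam : 0 < lam) {σ : Equiv.Perm (Fin M)} {ξ : Fin M → ℤˣ} {s : Fin M} {x : E}
    (hg : IsGreedyAt σ ξ s (T x)) (hd : DifferentiableAt ℝ (hardFunction T a lam σ ξ) x) :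
    lam ≤ ‖fderiv ℝ (hardFunction T a lam σ ξ) x‖ * W := by
  obtain ⟨w, hw, h⟩ := exists_signed_preimage hW σ ξ
  set g := fderiv ℝ (hardFunction T a lam σ ξ) x with hgdef
  have hδ : 0 < 4 / a := by positivity
  have ha1 : 1 / a ≤ 4 / a / 2 := by
    rw [div_div, div_le_div_iff₀ ha (by positivity)]; linarith
  have hdrop : ∀ t : ℝ, 0 < t → t ≤ 4 / a / 2 →
      hardFunction T a lam σ ξ (x + t • -w) - hardFunction T a lam σ ξ x ≤ -(lam * t) := by
    intro t ht htδ
    have h1 := quadInfConv_sub_le_sub ha (neg_mul_le_hardMax (δ := 4 / a) (σ := σ) (ξ := ξ))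
      hardMax_sub_le (y := T x) (z := t • T w) (t := t) fun u hu =>
        hardMax_sub_smul_le hg h (hu.trans ha1) ht htδ
    have h2 := mul_le_mul_of_nonneg_left h1 hlam.le
    have e : T (x + t • -w) = T x - t • T w := by
      rw [map_add, map_smul, map_neg, smul_neg, sub_eq_add_neg]
    simp only [hardFunction, e]
    linarith
  have hlim : Filter.Tendsto (fun t : ℝ => t⁻¹ •
      (hardFunction T a lam σ ξ (x + t • -w) - hardFunction T a lam σ ξ x))
      (nhdsWithin 0 (Set.Ioi 0)) (nhds (g (-w))) := by
    have := (hd.hasFDerivAt.hasLineDerivAt (-w)).tendsto_slope_zero_right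
    simpa using this
  have hle : g (-w) ≤ -lam := by
    refine le_of_tendsto hlim ?_
    filter_upwards [Ioc_mem_nhdsGT (half_pos hδ)] with t ht
    have := mul_le_mul_of_nonneg_left (hdrop t ht.1 ht.2) (inv_nonneg.2 ht.1.le)
    rw [smul_eq_mul]
    refine this.trans_eq ?_
    have := ht.1.ne'
    field_simp
  rw [map_neg, neg_le_neg_iff] at hle
  calc lam ≤ g w := hle
    _ ≤ ‖g w‖ := le_abs_self _
    _ ≤ ‖g‖ * ‖w‖ := g.le_opNorm w
    _ ≤ _ := by gcongr

/-- The lower bound in terms of a linear map `T` from `E` to a `K`-uniformly smooth space of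
dimension `M`: it bounds the complexity by `M` when `T` is bounded by `B` and each vector of signs
has a preimage of norm at most `W`. -/
theorem le_gradientComplexity
    (hK : ∀ u v : EllP r M, ‖u + v‖ ^ 2 + ‖u - v‖ ^ 2 ≤ 2 * ‖u‖ ^ 2 + 2 * K * ‖v‖ ^ 2)
    (hT : ∀ x, ‖T x‖ ≤ B * ‖x‖)
    (hW : ∀ η : Fin M → ℤˣ, ∃ w : E, ‖w‖ ≤ W ∧ ∀ i, T w i = ((η i : ℤ) : ℝ))
    {L κ R ε : ℝ} (hκ1 : 1 < κ) (hκ2 : κ ≤ 2) (hB : 0 < B) (hK0 : 0 < K) (hM : 0 < M) (hW0 : 0 < W)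
    (hL : 0 < L) (hR : 0 < R)
    (hε : ε * (2 * B * W * (16 * B * K * M * W) ^ (κ - 1)) < L * R ^ (κ - 1))
    {A : Type*} (O : problemClass E L κ R → E → A) (hO : IsLocalOracle (problemClass E L κ R) O) :
    (M : ℕ∞) ≤ gradientComplexity (problemClass E L κ R) O ε := by
  -- These choices of `a` and `lam` make the hard functions belong to the class exactly.
  obtain ⟨a, ha⟩ : ∃ a, a = 4 * M * W / R := ⟨_, rfl⟩
  obtain ⟨lam, hlam⟩ : ∃ lam, lam = L / (2 * B * (2 * (2 * a * K * B)) ^ (κ - 1)) := ⟨_, rfl⟩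
  have hM' : (0 : ℝ) < M := by exact_mod_cast hM
  have ha0 : 0 < a := by rw [ha]; positivity
  have hlam0 : 0 < lam := by rw [hlam]; positivity
  have hLeq : 2 * (lam * B) * (2 * (2 * a * K * B)) ^ (κ - 1) = L := by
    rw [hlam]; field_simp
  have hReq : 4 * M * W / a = R := by rw [ha]; field_simp
  have hεlam : ε * W < lam := by
    rw [hlam, lt_div_iff₀ (by positivity)]
    have e : (16 * B * K * M * W) ^ (κ - 1) =
        (2 * (2 * a * K * B)) ^ (κ - 1) * R ^ (κ - 1) := by
      rw [← Real.mul_rpow (by positivity) hR.le]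
      congr 1
      rw [ha]
      field_simp
      ring
    rw [e] at hε
    refine lt_of_mul_lt_mul_right ?_ (Real.rpow_nonneg hR.le (κ - 1))
    linarith
  have hmem : ∀ σ ξ, hardFunction T a lam σ ξ ∈ problemClass E L κ R := by
    intro σ ξ
    have := hardFunction_mem_problemClass hK hT hW hκ1 hκ2 hB hK0 ha0 hlam0 σ ξ
    rwa [hLeq, hReq] at this
  refine le_iInf fun alg => ?_
  obtain ⟨σ, ξ, hgreedy⟩ := exists_greedy_choices alg
    (fun σ ξ => O ⟨hardFunction T a lam σ ξ, hmem σ ξ⟩) (fun x => T x) (by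
      intro s x σ σ' ξ ξ' hagree hg hg'
      refine hO _ _ x ⟨1 / (a * B), by positivity, fun y hy => ?_⟩
      rw [mem_closedBall_iff_norm, le_div_iff₀ (by positivity)] at hy
      refine congrArg (lam * ·) (quadInfConv_congr ha0 neg_mul_le_hardMax neg_mul_le_hardMax
        hardMax_sub_le hardMax_sub_le fun u hu =>
          hardMax_congr hagree hg hg' (by positivity) ?_)
      have h1 : ‖T y - T x‖ ≤ 1 / a := by
        rw [← map_sub, le_div_iff₀ ha0]
        nlinarith [hT (y - x)]
      calc ‖u - T x‖ ≤ ‖u - T y‖ + ‖T y - T x‖ := norm_sub_le_norm_sub_add_norm_sub _ _ _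
        _ ≤ 1 / a + 1 / a := add_le_add hu h1
        _ = _ := by ring)
  refine le_trans ?_ (le_iSup _ (⟨hardFunction T a lam σ ξ, hmem σ ξ⟩ : problemClass E L κ R))
  refine le_iInf₂ fun k hk => ?_
  by_contra hlt
  rw [not_le, Nat.cast_lt] at hlt
  have h1 := le_norm_fderiv_hardFunction hW ha0 hlam0 (hgreedy ⟨k, hlt⟩)
    ((hmem σ ξ).2.1.1 _)
  have h2 := mul_le_mul_of_nonneg_right hk hW0.le
  linarith

end LowerBound

/-! ### Uniform smoothness of the norm with an even exponent -/

section UniformSmoothness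

/-- The odd part of `(a + b) ^ (2m)` is controlled by the even part; this is the second half of the
induction that proves the two-point inequality `pow_add_pow_le`. -/
theorem mul_pow_sub_pow_bounds (a b : ℝ) (m : ℕ) :
    0 ≤ a * b * (((a + b) ^ 2) ^ m - ((a - b) ^ 2) ^ m) ∧
      a * b * (((a + b) ^ 2) ^ m - ((a - b) ^ 2) ^ m) ≤
        2 * m * b ^ 2 * (((a + b) ^ 2) ^ m + ((a - b) ^ 2) ^ m) := by
  induction m with
  | zero => simp
  | succ m ih =>
    obtain ⟨h1, h2⟩ := ih
    have hs : 0 ≤ ((a + b) ^ 2) ^ m := by positivity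
    have ht : 0 ≤ ((a - b) ^ 2) ^ m := by positivity
    set s := ((a + b) ^ 2) ^ m
    set t := ((a - b) ^ 2) ^ m
    have e : a * b * (((a + b) ^ 2) ^ (m + 1) - ((a - b) ^ 2) ^ (m + 1)) =
        (a ^ 2 + b ^ 2) * (a * b * (s - t)) + 2 * (a * b) ^ 2 * (s + t) := by
      rw [pow_succ, pow_succ]; ring
    have e2 : ((a + b) ^ 2) ^ (m + 1) + ((a - b) ^ 2) ^ (m + 1) =
        (a ^ 2 + b ^ 2) * (s + t) + 2 * (a * b * (s - t)) := by
      rw [pow_succ, pow_succ]; ring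
    rw [e, e2]
    refine ⟨by positivity, ?_⟩
    have h3 := mul_le_mul_of_nonneg_left h2 (by positivity : 0 ≤ a ^ 2 + b ^ 2)
    have h4 : 0 ≤ 4 * ((m : ℝ) + 1) * b ^ 2 * (a * b * (s - t)) := by positivity
    have h5 : 0 ≤ 2 * b ^ 4 * (s + t) := by positivity
    push_cast
    linear_combination h3 + h4 + h5

/-- A two-point inequality with a constant of the order of the exponent. For even exponents it
follows by induction from the recursion for the even and odd parts of `(a + b) ^ (2m)`. -/
theorem pow_add_pow_le (a b c : ℝ) (m : ℕ) (hm : 4 * m ≤ c) :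
    ((a + b) ^ 2) ^ m + ((a - b) ^ 2) ^ m ≤ 2 * (a ^ 2 + c * b ^ 2) ^ m := by
  induction m with
  | zero => norm_num
  | succ m ih =>
    push_cast at hm
    have hc : 0 ≤ c := by linarith [(Nat.cast_nonneg m : (0 : ℝ) ≤ m)]
    have h1 := ih (by linarith)
    have h2 := (mul_pow_sub_pow_bounds a b m).2
    have hs : 0 ≤ ((a + b) ^ 2) ^ m := by positivity
    have ht : 0 ≤ ((a - b) ^ 2) ^ m := by positivity
    have e2 : ((a + b) ^ 2) ^ (m + 1) + ((a - b) ^ 2) ^ (m + 1) =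
        (a ^ 2 + b ^ 2) * (((a + b) ^ 2) ^ m + ((a - b) ^ 2) ^ m) +
          2 * (a * b * (((a + b) ^ 2) ^ m - ((a - b) ^ 2) ^ m)) := by
      rw [pow_succ, pow_succ]; ring
    rw [e2, pow_succ (a ^ 2 + c * b ^ 2)]
    set s := ((a + b) ^ 2) ^ m
    set t := ((a - b) ^ 2) ^ m
    have h3 : (a ^ 2 + b ^ 2 + 4 * m * b ^ 2) * (s + t) ≤ (a ^ 2 + c * b ^ 2) * (s + t) := by
      refine mul_le_mul_of_nonneg_right ?_ (add_nonneg hs ht)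
      linarith [mul_le_mul_of_nonneg_right hm (sq_nonneg b), sq_nonneg b]
    have h4 := mul_le_mul_of_nonneg_left h1 (by positivity : 0 ≤ a ^ 2 + c * b ^ 2)
    linarith

variable {ι : Type*} [Fintype ι] {m : ℕ}

theorem norm_sq_pow_eq_sum [Fact (1 ≤ ((2 * m : ℕ) : ℝ≥0∞))] (hm : 0 < m)
    (x : PiLp ((2 * m : ℕ) : ℝ≥0∞) fun _ : ι => ℝ) : (‖x‖ ^ 2) ^ m = ∑ i, (x i ^ 2) ^ m := by
  rw [PiLp.norm_eq_of_nat (2 * m) rfl, ← pow_mul, ← Real.rpow_natCast, ← Real.rpow_mul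
    (Finset.sum_nonneg fun _ _ => by positivity), one_div, inv_mul_cancel₀ (by positivity),
    Real.rpow_one]
  refine Finset.sum_congr rfl fun i _ => ?_
  rw [pow_mul, Real.norm_eq_abs, sq_abs]

/-- The `2m`-norm is uniformly smooth: its square has second differences of order `m`. -/
theorem norm_add_sq_add_norm_sub_sq_le [Fact (1 ≤ ((2 * m : ℕ) : ℝ≥0∞))] (hm : 0 < m)
    (x y : PiLp ((2 * m : ℕ) : ℝ≥0∞) fun _ : ι => ℝ) :
    ‖x + y‖ ^ 2 + ‖x - y‖ ^ 2 ≤ 2 * ‖x‖ ^ 2 + 2 * (4 * m) * ‖y‖ ^ 2 := by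
  have hm' : (0 : ℝ) < m := by exact_mod_cast hm
  have hroot : ∀ z : PiLp ((2 * m : ℕ) : ℝ≥0∞) fun _ : ι => ℝ,
      (∑ i, (z i ^ 2) ^ (m : ℝ)) ^ (1 / (m : ℝ)) = ‖z‖ ^ 2 := by
    intro z
    simp only [Real.rpow_natCast]
    rw [← norm_sq_pow_eq_sum hm, one_div, Real.pow_rpow_inv_natCast (by positivity) hm.ne']
  have hmink := Real.Lp_add_le_of_nonneg (s := Finset.univ) (f := fun i => x i ^ 2)
    (g := fun i => 4 * m * y i ^ 2) (p := m) (by exact_mod_cast hm)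
    (fun i _ => by positivity) (fun i _ => by positivity)
  have hscale : (∑ i, (4 * m * y i ^ 2) ^ (m : ℝ)) ^ (1 / (m : ℝ)) = 4 * m * ‖y‖ ^ 2 := by
    rw [← hroot y]
    simp only [Real.mul_rpow (by positivity : (0 : ℝ) ≤ 4 * m) (sq_nonneg _)]
    rw [← Finset.mul_sum, Real.mul_rpow (by positivity)
      (Finset.sum_nonneg fun _ _ => by positivity), ← Real.rpow_mul (by positivity),
      mul_one_div_cancel hm'.ne', Real.rpow_one]
  rw [hroot, hscale] at hmink
  have hS0 : 0 ≤ ∑ i, (x i ^ 2 + 4 * m * y i ^ 2) ^ m :=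
    Finset.sum_nonneg fun _ _ => by positivity
  have hmink2 : ∑ i, (x i ^ 2 + 4 * m * y i ^ 2) ^ m ≤ (‖x‖ ^ 2 + 4 * m * ‖y‖ ^ 2) ^ m := by
    simp only [Real.rpow_natCast, one_div] at hmink
    calc _ = ((∑ i, (x i ^ 2 + 4 * m * y i ^ 2) ^ m) ^ ((m : ℝ)⁻¹)) ^ m :=
          (Real.rpow_inv_natCast_pow hS0 hm.ne').symm
      _ ≤ _ := by gcongr
  have htwo : (‖x + y‖ ^ 2) ^ m + (‖x - y‖ ^ 2) ^ m ≤
      2 * ∑ i, (x i ^ 2 + 4 * m * y i ^ 2) ^ m := by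
    rw [norm_sq_pow_eq_sum hm, norm_sq_pow_eq_sum hm, ← Finset.sum_add_distrib, Finset.mul_sum]
    exact Finset.sum_le_sum fun i _ => pow_add_pow_le (x i) (y i) (4 * m) m le_rfl
  -- The means of order `1` and `m` of `‖x + y‖ ^ 2` and `‖x - y‖ ^ 2`.
  have hmean := (convexOn_pow m).2 (Set.mem_Ici.2 (sq_nonneg ‖x + y‖))
    (Set.mem_Ici.2 (sq_nonneg ‖x - y‖)) (by norm_num : (0 : ℝ) ≤ 1 / 2)
    (by norm_num : (0 : ℝ) ≤ 1 / 2) (by norm_num)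
  simp only [smul_eq_mul] at hmean
  have h := le_of_pow_le_pow_left₀ hm.ne' (by positivity)
    (show (1 / 2 * ‖x + y‖ ^ 2 + 1 / 2 * ‖x - y‖ ^ 2) ^ m ≤ (‖x‖ ^ 2 + 4 * m * ‖y‖ ^ 2) ^ m by
      linarith)
  linarith

end UniformSmoothness

/-! ### The coordinate map -/

section CoordinateMap

variable {d M m : ℕ} {p : ℝ≥0∞} [Fact (1 ≤ p)]

theorem norm_rpow_eq_sum (hp : p ≠ ∞) (x : EllP p d) :
    ‖x‖ ^ p.toReal = ∑ k, |x k| ^ p.toReal := by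
  have hp0 : 0 < p.toReal :=
    ENNReal.toReal_pos (zero_lt_one.trans_le (Fact.out : 1 ≤ p)).ne' hp
  rw [PiLp.norm_eq_sum hp0, ← Real.rpow_mul (Finset.sum_nonneg fun _ _ => by positivity),
    one_div_mul_cancel hp0.ne', Real.rpow_one]
  rfl

/-- In dimension at most `4 ^ m` the `2m`-norm is equivalent to the maximum norm. -/
theorem norm_le_two_mul_of_abs_le [Fact (1 ≤ ((2 * m : ℕ) : ℝ≥0∞))] (hm : 0 < m)
    (hM : (M : ℝ) ≤ 4 ^ m) {b : ℝ} {z : EllP ((2 * m : ℕ) : ℝ≥0∞) M} (hb : 0 ≤ b)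
    (hz : ∀ i, |z i| ≤ b) :
    ‖z‖ ≤ 2 * b := by
  have h : (‖z‖ ^ 2) ^ m ≤ ((2 * b) ^ 2) ^ m := by
    rw [norm_sq_pow_eq_sum hm]
    calc ∑ i, (z i ^ 2) ^ m ≤ ∑ _i : Fin M, (b ^ 2) ^ m := by
          refine Finset.sum_le_sum fun i _ => ?_
          rw [← sq_abs]
          gcongr
          exact hz i
      _ = M * (b ^ 2) ^ m := by simp
      _ ≤ 4 ^ m * (b ^ 2) ^ m := by gcongr
      _ = _ := by rw [← mul_pow, mul_pow 2 b]; norm_num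
  exact le_of_sq_le_sq (le_of_pow_le_pow_left₀ hm.ne' (by positivity) h) (by positivity)

theorem sum_pow_le_norm_pow (hp : p ≠ ∞) (hpm : p.toReal ≤ (2 * m : ℕ)) (x : EllP p d) :
    ∑ k, (x k ^ 2) ^ m ≤ (‖x‖ ^ 2) ^ m := by
  have hpow : ∀ t : ℝ, 0 ≤ t → (t ^ 2) ^ m = t ^ (((2 * m : ℕ) : ℝ) - p.toReal) * t ^ p.toReal := by
    intro t ht
    have hp0 : 0 < p.toReal :=
      ENNReal.toReal_pos (zero_lt_one.trans_le (Fact.out : 1 ≤ p)).ne' hp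
    rw [← Real.rpow_add_of_nonneg ht (by linarith) hp0.le, sub_add_cancel, Real.rpow_natCast,
      pow_mul]
  rw [hpow _ (norm_nonneg x), norm_rpow_eq_sum hp, Finset.mul_sum]
  refine Finset.sum_le_sum fun k _ => ?_
  rw [← sq_abs, hpow _ (abs_nonneg _)]
  have := PiLp.norm_apply_le x k
  rw [Real.norm_eq_abs] at this
  gcongr

/-- The projection onto the first `M` coordinates, as a map from `ℝ^d` with the `p`-norm to `ℝ^M`
with the `r`-norm. -/
def coordinateMap (p r : ℝ≥0∞) [Fact (1 ≤ p)] [Fact (1 ≤ r)] (h : M ≤ d) :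
    EllP p d →L[ℝ] EllP r M :=
  LinearMap.toContinuousLinearMap
    { toFun := fun x => WithLp.toLp r fun i => x (Fin.castLE h i)
      map_add' := fun _ _ => rfl
      map_smul' := fun _ _ => rfl }

theorem coordinateMap_apply {r : ℝ≥0∞} [Fact (1 ≤ r)] (h : M ≤ d) (x : EllP p d) (i : Fin M) :
    coordinateMap p r h x i = x (Fin.castLE h i) := rfl

theorem norm_coordinateMap_le [Fact (1 ≤ ((2 * m : ℕ) : ℝ≥0∞))] (hm : 0 < m) (h : M ≤ d)
    (hpm : (p ≠ ∞ ∧ p.toReal ≤ (2 * m : ℕ)) ∨ (M : ℝ) ≤ 4 ^ m) (x : EllP p d) :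
    ‖coordinateMap p ((2 * m : ℕ) : ℝ≥0∞) h x‖ ≤ 2 * ‖x‖ := by
  rcases hpm with ⟨hp, hpm⟩ | hM
  · have h1 : (‖coordinateMap p ((2 * m : ℕ) : ℝ≥0∞) h x‖ ^ 2) ^ m ≤ (‖x‖ ^ 2) ^ m := by
      refine le_trans ?_ (sum_pow_le_norm_pow hp hpm x)
      rw [norm_sq_pow_eq_sum hm]
      simp only [coordinateMap_apply]
      refine (Finset.sum_map Finset.univ (Fin.castLEEmb h) fun k => (x k ^ 2) ^ m).symm.trans_le ?_
      exact Finset.sum_le_univ_sum_of_nonneg fun k => by positivity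
    have h2 := le_of_sq_le_sq (le_of_pow_le_pow_left₀ hm.ne' (by positivity) h1) (norm_nonneg x)
    linarith [norm_nonneg x]
  · exact norm_le_two_mul_of_abs_le hm hM (norm_nonneg x) fun i => PiLp.norm_apply_le x _

theorem exists_coordinateMap_eq {r : ℝ≥0∞} [Fact (1 ≤ r)] (h : M ≤ d)
    (η : Fin M → ℤˣ) :
    ∃ w : EllP p d, ‖w‖ ≤ (M : ℝ) ^ (1 / p.toReal) ∧
      ∀ i, coordinateMap p r h w i = ((η i : ℤ) : ℝ) := by
  have hinj := Fin.castLE_injective h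
  set v : Fin d → ℝ := Function.extend (Fin.castLE h) (fun i => ((η i : ℤ) : ℝ)) 0 with hv
  have hv1 : ∀ i, v (Fin.castLE h i) = ((η i : ℤ) : ℝ) := fun i => hinj.extend_apply _ _ i
  have hv0 : ∀ k, k ∉ Set.range (Fin.castLE h) → v k = 0 := fun k hk => by
    rw [hv, Function.extend_apply' _ _ _ hk, Pi.zero_apply]
  refine ⟨WithLp.toLp p v, ?_, hv1⟩
  by_cases hp : p = ∞
  · subst hp
    rw [ENNReal.toReal_top, div_zero, Real.rpow_zero, PiLp.norm_toLp]
    refine (pi_norm_le_iff_of_nonneg zero_le_one).2 fun k => ?_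
    by_cases hk : k ∈ Set.range (Fin.castLE h)
    · obtain ⟨i, rfl⟩ := hk
      rw [hv1, Real.norm_eq_abs, abs_intCast_unit]
    · rw [hv0 k hk, norm_zero]
      exact zero_le_one
  · have hp0 : 0 < p.toReal :=
      ENNReal.toReal_pos (zero_lt_one.trans_le (Fact.out : 1 ≤ p)).ne' hp
    have hsum : ∑ k, |v k| ^ p.toReal = M := by
      rw [← Fintype.sum_of_injective (Fin.castLE h) hinj (fun _ => (1 : ℝ))
        (fun k => |v k| ^ p.toReal) (fun k hk => ?_) (fun i => ?_)]
      · simp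
      · rw [hv0 k hk, abs_zero, Real.zero_rpow hp0.ne']
      · rw [hv1, abs_intCast_unit, Real.one_rpow]
    rw [one_div, Real.le_rpow_inv_iff_of_pos (norm_nonneg _) (Nat.cast_nonneg _) hp0,
      norm_rpow_eq_sum hp]
    exact hsum.le

end CoordinateMap

/-! ### The Hartley transform -/

section HartleyMap

/-- The entries `cos + sin` of the (unnormalized) Hartley transform. -/
def hartley (d j k : ℕ) : ℝ :=
  Real.cos (2 * Real.pi * (j * k) / d) + Real.sin (2 * Real.pi * (j * k) / d)

theorem abs_hartley_le (d j k : ℕ) : |hartley d j k| ≤ 2 := by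
  refine (abs_add_le _ _).trans ?_
  linarith [Real.abs_cos_le_one (2 * Real.pi * (j * k) / d),
    Real.abs_sin_le_one (2 * Real.pi * (j * k) / d)]

theorem sum_exp_pow_eq {d : ℕ} (hd : 0 < d) (n : ℤ) :
    ∑ k ∈ Finset.range d, Complex.exp (2 * Real.pi * Complex.I * (n / d)) ^ k =
      if (d : ℤ) ∣ n then (d : ℂ) else 0 := by
  have hd' : (d : ℂ) ≠ 0 := by exact_mod_cast hd.ne'
  set ω := Complex.exp (2 * Real.pi * Complex.I * (n / d)) with hω
  have hone : ω = 1 ↔ (d : ℤ) ∣ n := by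
    rw [hω, Complex.exp_eq_one_iff]
    constructor
    · rintro ⟨l, hl⟩
      refine ⟨l, ?_⟩
      have : (n : ℂ) / d = l := by
        refine mul_left_cancel₀ Complex.two_pi_I_ne_zero ?_
        rw [hl]; ring
      rw [div_eq_iff hd'] at this
      have h2 : (n : ℂ) = ((d * l : ℤ) : ℂ) := by rw [this]; push_cast; ring
      exact_mod_cast h2
    · rintro ⟨l, rfl⟩
      refine ⟨l, ?_⟩
      push_cast
      field_simp
  have hpow : ω ^ d = 1 := by
    rw [hω, ← Complex.exp_nat_mul, Complex.exp_eq_one_iff]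
    refine ⟨n, ?_⟩
    field_simp
  split_ifs with h
  · simp [hone.2 h]
  · rw [geom_sum_eq (fun h1 => h (hone.1 h1)), hpow, sub_self, zero_div]

theorem sum_cos_sin_eq {d : ℕ} (hd : 0 < d) (n : ℤ) :
    ∑ k ∈ Finset.range d, Real.cos (2 * Real.pi * (n * k) / d) =
        (if (d : ℤ) ∣ n then (d : ℝ) else 0) ∧
      ∑ k ∈ Finset.range d, Real.sin (2 * Real.pi * (n * k) / d) = 0 := by
  have hd' : (d : ℂ) ≠ 0 := by exact_mod_cast hd.ne'
  have hexp : ∀ k : ℕ, Complex.exp (2 * Real.pi * Complex.I * (n / d)) ^ k =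
      Complex.exp (((2 * Real.pi * (n * k) / d : ℝ) : ℂ) * Complex.I) := by
    intro k
    rw [← Complex.exp_nat_mul]
    congr 1
    push_cast
    field_simp
  have h := sum_exp_pow_eq hd n
  simp only [hexp] at h
  refine ⟨?_, ?_⟩
  · have := congrArg Complex.re h
    rw [Complex.re_sum] at this
    simp only [Complex.exp_ofReal_mul_I_re] at this
    rw [this]
    split_ifs <;> simp
  · have := congrArg Complex.im h
    rw [Complex.im_sum] at this
    simp only [Complex.exp_ofReal_mul_I_im] at this
    rw [this]
    split_ifs <;> simp

theorem sum_hartley_mul_hartley {d : ℕ} (j l : Fin d) :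
    ∑ k : Fin d, hartley d j k * hartley d l k = if j = l then (d : ℝ) else 0 := by
  have hd : 0 < d := j.pos
  rw [Fin.sum_univ_eq_sum_range (fun k => hartley d j k * hartley d l k)]
  have e : ∀ k : ℕ, hartley d j k * hartley d l k =
      Real.cos (2 * Real.pi * (((j - l : ℤ) : ℝ) * k) / d) +
        Real.sin (2 * Real.pi * (((j + l : ℤ) : ℝ) * k) / d) := by
    intro k
    have e1 : 2 * Real.pi * (((j - l : ℤ) : ℝ) * k) / d =
        2 * Real.pi * (j * k) / d - 2 * Real.pi * (l * k) / d := by push_cast; ring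
    have e2 : 2 * Real.pi * (((j + l : ℤ) : ℝ) * k) / d =
        2 * Real.pi * (j * k) / d + 2 * Real.pi * (l * k) / d := by push_cast; ring
    rw [e1, e2, Real.cos_sub, Real.sin_add, hartley, hartley]
    ring
  simp only [e]
  rw [Finset.sum_add_distrib, (sum_cos_sin_eq hd _).1, (sum_cos_sin_eq hd _).2, add_zero]
  have hiff : (d : ℤ) ∣ (j - l : ℤ) ↔ j = l := by
    constructor
    · intro h
      have h1 : ((j : ℕ) : ℤ) - (l : ℕ) = 0 :=
        Int.eq_zero_of_abs_lt_dvd h (by rw [abs_lt]; constructor <;> omega)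
      exact Fin.ext (by omega)
    · rintro rfl
      simp
  simp only [hiff]

variable {d M m : ℕ} {p : ℝ≥0∞} [Fact (1 ≤ p)]

theorem sum_abs_le_rpow_mul_norm (hp : p ≠ ∞) (x : EllP p d) :
    ∑ k, |x k| ≤ (d : ℝ) ^ (1 - 1 / p.toReal) * ‖x‖ := by
  have hp1 : 1 ≤ p.toReal := by
    rw [← ENNReal.toReal_one]
    exact ENNReal.toReal_mono hp Fact.out
  have hp0 : 0 < p.toReal := by linarith
  have h := Real.rpow_sum_le_const_mul_sum_rpow Finset.univ (fun k => x k) hp1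
  rw [← norm_rpow_eq_sum hp, Finset.card_univ, Fintype.card_fin] at h
  rw [← Real.rpow_le_rpow_iff (Finset.sum_nonneg fun _ _ => abs_nonneg _) (by positivity) hp0,
    Real.mul_rpow (by positivity) (norm_nonneg _), ← Real.rpow_mul (Nat.cast_nonneg d), sub_mul,
    one_mul, one_div_mul_cancel hp0.ne']
  exact h

/-- The first `M` rows of the Hartley transform, scaled so that their dual norms are of order `1`. -/
def hartleyMap (p r : ℝ≥0∞) [Fact (1 ≤ p)] [Fact (1 ≤ r)] (d M : ℕ) : EllP p d →L[ℝ] EllP r M :=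
  LinearMap.toContinuousLinearMap
    { toFun := fun x => WithLp.toLp r fun i : Fin M =>
        (d : ℝ) ^ (1 / p.toReal - 1) * ∑ k : Fin d, hartley d i k * x k
      map_add' := fun x y => by
        ext i
        simp [mul_add, Finset.sum_add_distrib]
      map_smul' := fun c x => by
        ext i
        simp only [PiLp.smul_apply, smul_eq_mul, RingHom.id_apply, Finset.mul_sum]
        exact Finset.sum_congr rfl fun k _ => by ring }

theorem hartleyMap_apply {r : ℝ≥0∞} [Fact (1 ≤ r)] (x : EllP p d) (i : Fin M) :
    hartleyMap p r d M x i = (d : ℝ) ^ (1 / p.toReal - 1) * ∑ k : Fin d, hartley d i k * x k := rfl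

theorem norm_hartleyMap_le [Fact (1 ≤ ((2 * m : ℕ) : ℝ≥0∞))] (hm : 0 < m) (hd : 0 < d)
    (hM : (M : ℝ) ≤ 4 ^ m) (hp : p ≠ ∞) (x : EllP p d) :
    ‖hartleyMap p ((2 * m : ℕ) : ℝ≥0∞) d M x‖ ≤ 4 * ‖x‖ := by
  have hd' : (0 : ℝ) < d := by exact_mod_cast hd
  refine (norm_le_two_mul_of_abs_le hm hM (b := 2 * ‖x‖) (by positivity) fun i => ?_).trans_eq
    (by ring)
  rw [hartleyMap_apply, abs_mul, abs_of_pos (by positivity)]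
  calc _ ≤ (d : ℝ) ^ (1 / p.toReal - 1) * ∑ k : Fin d, 2 * |x k| := by
        gcongr
        refine (Finset.abs_sum_le_sum_abs _ _).trans (Finset.sum_le_sum fun k _ => ?_)
        rw [abs_mul]
        gcongr
        exact abs_hartley_le _ _ _
    _ ≤ (d : ℝ) ^ (1 / p.toReal - 1) * (2 * ((d : ℝ) ^ (1 - 1 / p.toReal) * ‖x‖)) := by
        rw [← Finset.mul_sum]
        gcongr
        exact sum_abs_le_rpow_mul_norm hp x
    _ = (d : ℝ) ^ (1 / p.toReal - 1 + (1 - 1 / p.toReal)) * (2 * ‖x‖) := by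
        rw [Real.rpow_add hd']; ring
    _ = _ := by rw [show 1 / p.toReal - 1 + (1 - 1 / p.toReal) = 0 by ring, Real.rpow_zero, one_mul]

/-- By orthogonality the Hartley transform of a vector of `M` signs has Euclidean norm `√(dM)`; for
`p < 2` this bounds its `p`-norm. -/
theorem exists_hartleyMap_eq {r : ℝ≥0∞} [Fact (1 ≤ r)] (hd : 0 < d) (h : M ≤ d) (hp : p < 2)
    (η : Fin M → ℤˣ) :
    ∃ w : EllP p d, ‖w‖ ≤ (M : ℝ) ^ (1 / 2 : ℝ) ∧
      ∀ i, hartleyMap p r d M w i = ((η i : ℤ) : ℝ) := by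
  have hd' : (0 : ℝ) < d := by exact_mod_cast hd
  have hp' : p ≠ ∞ := (hp.trans (by simp)).ne
  have hp0 : 0 < p.toReal :=
    ENNReal.toReal_pos (zero_lt_one.trans_le (Fact.out : 1 ≤ p)).ne' hp'
  have hp2 : p.toReal ≤ 2 := by
    have := ENNReal.toReal_mono (by simp) hp.le
    simpa using this
  have horth : ∀ i j : Fin M, ∑ k : Fin d, hartley d i k * hartley d j k =
      if i = j then (d : ℝ) else 0 := by
    intro i j
    have := sum_hartley_mul_hartley (Fin.castLE h i) (Fin.castLE h j)
    simpa using this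
  set s : Fin d → ℝ := fun k => ∑ j, ((η j : ℤ) : ℝ) * hartley d j k with hs
  have hinner : ∀ i : Fin M, ∑ k : Fin d, hartley d i k * s k = d * ((η i : ℤ) : ℝ) := by
    intro i
    simp only [hs, Finset.mul_sum]
    rw [Finset.sum_comm]
    have : ∀ j : Fin M, ∑ k : Fin d, hartley d i k * (((η j : ℤ) : ℝ) * hartley d j k) =
        if i = j then (d : ℝ) * ((η j : ℤ) : ℝ) else 0 := by
      intro j
      calc _ = ((η j : ℤ) : ℝ) * ∑ k : Fin d, hartley d i k * hartley d j k := by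
            rw [Finset.mul_sum]
            exact Finset.sum_congr rfl fun k _ => by ring
        _ = _ := by rw [horth]; split_ifs <;> ring
    simp only [this, Finset.sum_ite_eq, Finset.mem_univ, if_true]
  have hsq : ∑ k, s k ^ 2 = d * M := by
    calc ∑ k, s k ^ 2 = ∑ k : Fin d, ∑ j, ((η j : ℤ) : ℝ) * (hartley d j k * s k) := by
          refine Finset.sum_congr rfl fun k _ => ?_
          rw [sq]
          nth_rewrite 1 [hs]
          rw [Finset.sum_mul]
          exact Finset.sum_congr rfl fun j _ => by ring
      _ = ∑ j : Fin M, ((η j : ℤ) : ℝ) * (d * ((η j : ℤ) : ℝ)) := by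
          rw [Finset.sum_comm]
          refine Finset.sum_congr rfl fun j _ => ?_
          rw [← Finset.mul_sum, hinner]
      _ = ∑ j : Fin M, (d : ℝ) := by
          refine Finset.sum_congr rfl fun j _ => ?_
          have : ((η j : ℤ) : ℝ) * ((η j : ℤ) : ℝ) = 1 := by
            rw [← abs_mul_abs_self, abs_intCast_unit, one_mul]
          linear_combination (d : ℝ) * this
      _ = d * M := by simp [mul_comm]
  have hsp : ∑ k, |s k| ^ p.toReal ≤ d * (M : ℝ) ^ (p.toReal / 2) := by
    have h1 := Real.rpow_sum_le_const_mul_sum_rpow_of_nonneg Finset.univ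
      (f := fun k => |s k| ^ p.toReal) (p := 2 / p.toReal) (by rw [le_div_iff₀ hp0]; linarith)
      fun k _ => by positivity
    have h2 : ∀ k, (|s k| ^ p.toReal) ^ (2 / p.toReal) = s k ^ 2 := by
      intro k
      rw [← Real.rpow_mul (abs_nonneg _), mul_div_cancel₀ _ hp0.ne', Real.rpow_two, sq_abs]
    simp only [h2] at h1
    rw [hsq, Finset.card_univ, Fintype.card_fin, ← mul_assoc, ← Real.rpow_add_one hd'.ne',
      sub_add_cancel] at h1
    have h3 : (0 : ℝ) ≤ ∑ k, |s k| ^ p.toReal := Finset.sum_nonneg fun _ _ => by positivity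
    have h4 := Real.rpow_le_rpow (by positivity) h1 (by positivity : 0 ≤ p.toReal / 2)
    rw [Real.mul_rpow (by positivity) (by positivity), ← Real.rpow_mul h3,
      ← Real.rpow_mul hd'.le] at h4
    have e : 2 / p.toReal * (p.toReal / 2) = 1 := by field_simp
    rwa [e, Real.rpow_one, Real.rpow_one] at h4
  refine ⟨WithLp.toLp p fun k => (d : ℝ) ^ (-(1 / p.toReal)) * s k, ?_, fun i => ?_⟩
  · rw [← Real.rpow_le_rpow_iff (norm_nonneg _) (by positivity) hp0, norm_rpow_eq_sum hp',
      ← Real.rpow_mul (by positivity), one_div_mul_eq_div]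
    have e : ∀ k, |(d : ℝ) ^ (-(1 / p.toReal)) * s k| ^ p.toReal =
        (d : ℝ)⁻¹ * |s k| ^ p.toReal := by
      intro k
      rw [abs_mul, abs_of_pos (by positivity), Real.mul_rpow (by positivity) (abs_nonneg _),
        ← Real.rpow_mul hd'.le, neg_mul, one_div_mul_cancel hp0.ne', Real.rpow_neg_one]
    simp only [e]
    rw [← Finset.mul_sum, inv_mul_le_iff₀ hd']
    exact hsp
  · rw [hartleyMap_apply]
    have e : ∑ k : Fin d, hartley d i k * ((d : ℝ) ^ (-(1 / p.toReal)) * s k) =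
        (d : ℝ) ^ (-(1 / p.toReal)) * (d * ((η i : ℤ) : ℝ)) := by
      rw [← hinner, Finset.mul_sum]
      exact Finset.sum_congr rfl fun k _ => by ring
    rw [e, ← mul_assoc, ← Real.rpow_add hd', ← mul_assoc, ← Real.rpow_add_one hd'.ne',
      show 1 / p.toReal - 1 + -(1 / p.toReal) + 1 = 0 by ring, Real.rpow_zero, one_mul]

end HartleyMap

/-! ### The rates -/

section Rates

theorem half_le_log {d : ℕ} (hd : 2 ≤ d) : 1 / 2 ≤ Real.log d := by
  have h1 : Real.log 2 ≤ Real.log d := Real.log_le_log (by norm_num) (by exact_mod_cast hd)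
  linarith [Real.log_two_gt_d9]

theorem natCast_le_four_pow {d M m : ℕ} (hd : 2 ≤ d) (hM : M ≤ d) (hm : Real.log d ≤ m) :
    (M : ℝ) ≤ 4 ^ m := by
  have hd' : (0 : ℝ) < d := by exact_mod_cast (by omega : 0 < d)
  calc (M : ℝ) ≤ d := by exact_mod_cast hM
    _ = Real.exp (Real.log d) := (Real.exp_log hd').symm
    _ ≤ Real.exp m := Real.exp_le_exp.2 hm
    _ = Real.exp 1 ^ m := by rw [← Real.exp_nat_mul, mul_one]
    _ ≤ 4 ^ m := by
      gcongr
      linarith [Real.exp_one_lt_d9]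

/-- The abstract lower bound for a target space with the `2⌈q⌉`-norm and for preimages of sign
vectors of norm `M ^ τ`, where `M = ⌈N⌉`: the complexity is at least `N` if, up to a constant,
`N ^ (κτ + κ - 1)` is at most `L R ^ (κ - 1) / (ε q ^ (κ - 1))`. -/
theorem ofReal_le_gradientComplexity {E : Type*} [NormedAddCommGroup E] [NormedSpace ℝ E]
    {κ L R ε N τ q : ℝ} {M m : ℕ} (hMN : M = ⌈N⌉₊) (hmq : m = ⌈q⌉₊)
    [Fact (1 ≤ ((2 * m : ℕ) : ℝ≥0∞))] (T : E →L[ℝ] EllP ((2 * m : ℕ) : ℝ≥0∞) M)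
    (hT : ∀ x, ‖T x‖ ≤ 4 * ‖x‖)
    (hW : ∀ η : Fin M → ℤˣ, ∃ w : E, ‖w‖ ≤ (M : ℝ) ^ τ ∧ ∀ i, T w i = ((η i : ℤ) : ℝ))
    (hκ1 : 1 < κ) (hκ2 : κ ≤ 2) (hL : 0 < L) (hR : 0 < R) (hε : 0 < ε) (hτ0 : 0 ≤ τ)
    (hτ : τ ≤ 1 / 2) (hq : 1 / 2 ≤ q) (hN : 1 ≤ N)
    (hrate : 24576 * N ^ (κ * τ + κ - 1) < L * R ^ (κ - 1) / (ε * q ^ (κ - 1)))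
    {V : Type*} (O : problemClass E L κ R → E → V) (hO : IsLocalOracle (problemClass E L κ R) O) :
    ENNReal.ofReal N ≤ (gradientComplexity (problemClass E L κ R) O ε : ℝ≥0∞) := by
  have hm : 0 < m := by rw [hmq]; exact Nat.ceil_pos.2 (by linarith)
  have hM : 0 < M := by rw [hMN]; exact Nat.ceil_pos.2 (by linarith)
  have hM' : (0 : ℝ) < M := by exact_mod_cast hM
  have hm' : (0 : ℝ) < m := by exact_mod_cast hm
  have hNM : N ≤ M := by rw [hMN]; exact Nat.le_ceil N
  have hM2 : (M : ℝ) ≤ 2 * N := by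
    rw [hMN]; linarith [Nat.ceil_lt_add_one (by linarith : 0 ≤ N)]
  have hm3 : (m : ℝ) ≤ 3 * q := by
    rw [hmq]; linarith [Nat.ceil_lt_add_one (by linarith : 0 ≤ q)]
  have hq0 : 0 < q := by linarith
  have hN0 : 0 < N := by linarith
  have hMpow : (M : ℝ) ^ (κ * τ + κ - 1) ≤ 4 * N ^ (κ * τ + κ - 1) := by
    have hθ0 : 0 ≤ κ * τ + κ - 1 := by nlinarith
    have hθ2 : κ * τ + κ - 1 ≤ 2 := by nlinarith
    calc (M : ℝ) ^ (κ * τ + κ - 1) ≤ (2 * N) ^ (κ * τ + κ - 1) := by gcongr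
      _ = 2 ^ (κ * τ + κ - 1) * N ^ (κ * τ + κ - 1) := Real.mul_rpow (by norm_num) hN0.le
      _ ≤ 2 ^ (2 : ℝ) * N ^ (κ * τ + κ - 1) := by
        gcongr
        norm_num
      _ = _ := by norm_num
  have hpow : 2 * 4 * (M : ℝ) ^ τ * (16 * 4 * (4 * m) * M * (M : ℝ) ^ τ) ^ (κ - 1) ≤
      24576 * N ^ (κ * τ + κ - 1) * q ^ (κ - 1) := by
    calc _ ≤ 2 * 4 * (M : ℝ) ^ τ * (16 * 4 * (4 * (3 * q)) * M * (M : ℝ) ^ τ) ^ (κ - 1) := by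
          gcongr
      _ = 8 * (768 : ℝ) ^ (κ - 1) * ((M : ℝ) ^ τ * ((M : ℝ) ^ (1 + τ)) ^ (κ - 1)) *
            q ^ (κ - 1) := by
          rw [show 16 * 4 * (4 * (3 * q)) * M * (M : ℝ) ^ τ = 768 * (M : ℝ) ^ (1 + τ) * q by
              rw [Real.rpow_add hM', Real.rpow_one]; ring,
            Real.mul_rpow (by positivity) hq0.le, Real.mul_rpow (by norm_num) (by positivity)]
          ring
      _ = 8 * (768 : ℝ) ^ (κ - 1) * (M : ℝ) ^ (κ * τ + κ - 1) * q ^ (κ - 1) := by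
          rw [← Real.rpow_mul hM'.le, ← Real.rpow_add hM',
            show τ + (1 + τ) * (κ - 1) = κ * τ + κ - 1 by ring]
      _ ≤ 8 * (768 : ℝ) ^ (1 : ℝ) * (4 * N ^ (κ * τ + κ - 1)) * q ^ (κ - 1) := by
          gcongr
          · norm_num
          · linarith
      _ = _ := by rw [Real.rpow_one]; ring
  have hkey := le_gradientComplexity (B := 4) (K := 4 * m) (W := (M : ℝ) ^ τ)
    (norm_add_sq_add_norm_sub_sq_le hm) hT hW hκ1 hκ2 (by norm_num) (by positivity) hM
    (by positivity) hL hR (by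
      refine (mul_le_mul_of_nonneg_left hpow hε.le).trans_lt ?_
      rw [lt_div_iff₀ (by positivity)] at hrate
      linarith) O hO
  calc ENNReal.ofReal N ≤ ENNReal.ofReal M := ENNReal.ofReal_le_ofReal hNM
    _ = ((M : ℕ∞) : ℝ≥0∞) := by rw [ENNReal.ofReal_natCast, ENat.toENNReal_coe]
    _ ≤ _ := ENat.toENNReal_le.2 hkey

theorem fact_one_le_two_mul {m : ℕ} (hm : 0 < m) : Fact (1 ≤ ((2 * m : ℕ) : ℝ≥0∞)) :=
  ⟨by exact_mod_cast (by omega : 1 ≤ 2 * m)⟩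

/-- The lower bound from the coordinate map. In the `2⌈q⌉`-norm that map is bounded either because
`p ≤ q` or because the `2⌈q⌉`-norm is equivalent to the maximum norm. -/
theorem ofReal_le_gradientComplexity_of_coordinates {p : ℝ≥0∞} [Fact (1 ≤ p)] {d : ℕ}
    {κ L R ε N q : ℝ} (hd : 2 ≤ d) (hp2 : 2 ≤ p)
    (hpq : (p ≠ ∞ ∧ p.toReal ≤ q) ∨ Real.log d ≤ q)
    (hκ1 : 1 < κ) (hκ2 : κ ≤ 2) (hL : 0 < L) (hR : 0 < R) (hε : 0 < ε) (hq : 1 / 2 ≤ q)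
    (hN : 1 ≤ N) (hNd : N ≤ d)
    (hrate : 24576 * N ^ (κ * (1 / p.toReal) + κ - 1) < L * R ^ (κ - 1) / (ε * q ^ (κ - 1)))
    {V : Type*} (O : problemClass (EllP p d) L κ R → EllP p d → V)
    (hO : IsLocalOracle (problemClass (EllP p d) L κ R) O) :
    ENNReal.ofReal N ≤ (gradientComplexity (problemClass (EllP p d) L κ R) O ε : ℝ≥0∞) := by
  have hm : 0 < ⌈q⌉₊ := Nat.ceil_pos.2 (by linarith)
  have hMd : ⌈N⌉₊ ≤ d := Nat.ceil_le.2 hNd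
  have := fact_one_le_two_mul hm
  have hqm : q ≤ ⌈q⌉₊ := Nat.le_ceil q
  have hpm : (p ≠ ∞ ∧ p.toReal ≤ (2 * ⌈q⌉₊ : ℕ)) ∨ (⌈N⌉₊ : ℝ) ≤ 4 ^ ⌈q⌉₊ := by
    refine hpq.imp (fun h => ⟨h.1, ?_⟩) fun h => natCast_le_four_pow hd hMd (h.trans hqm)
    push_cast
    linarith [h.2]
  have hτ : 1 / p.toReal ≤ 1 / 2 := by
    by_cases hp : p = ∞
    · simp [hp]
    · have := ENNReal.toReal_mono hp hp2
      rw [ENNReal.toReal_ofNat] at this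
      exact one_div_le_one_div_of_le (by norm_num) this
  refine ofReal_le_gradientComplexity rfl rfl (coordinateMap p _ hMd) (fun x => ?_)
    (exists_coordinateMap_eq hMd) hκ1 hκ2 hL hR hε (by positivity) hτ hq hN hrate O hO
  linarith [norm_coordinateMap_le hm hMd hpm x, norm_nonneg x]

theorem ofReal_le_gradientComplexity_of_hartley {p : ℝ≥0∞} [Fact (1 ≤ p)] {d : ℕ}
    {κ L R ε N : ℝ} (hd : 2 ≤ d) (hp2 : p < 2)
    (hκ1 : 1 < κ) (hκ2 : κ ≤ 2) (hL : 0 < L) (hR : 0 < R) (hε : 0 < ε)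
    (hN : 1 ≤ N) (hNd : N ≤ d)
    (hrate : 24576 * N ^ (κ * (1 / 2) + κ - 1) < L * R ^ (κ - 1) / (ε * Real.log d ^ (κ - 1)))
    {V : Type*} (O : problemClass (EllP p d) L κ R → EllP p d → V)
    (hO : IsLocalOracle (problemClass (EllP p d) L κ R) O) :
    ENNReal.ofReal N ≤ (gradientComplexity (problemClass (EllP p d) L κ R) O ε : ℝ≥0∞) := by
  have hq := half_le_log hd
  have hm : 0 < ⌈Real.log d⌉₊ := Nat.ceil_pos.2 (by linarith)
  have hMd : ⌈N⌉₊ ≤ d := Nat.ceil_le.2 hNd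
  have := fact_one_le_two_mul hm
  exact ofReal_le_gradientComplexity rfl rfl (hartleyMap p _ d _)
    (norm_hartleyMap_le hm (by omega) (natCast_le_four_pow hd hMd (Nat.le_ceil _))
      (hp2.trans (by simp)).ne)
    (exists_hartleyMap_eq (by omega) hMd hp2) hκ1 hκ2 hL hR hε (by norm_num) le_rfl hq hN hrate O hO

theorem rateBelowTwo_le {p : ℝ≥0∞} [Fact (1 ≤ p)] {d : ℕ} {κ L R ε : ℝ} {V : Type*}
    (O : problemClass (EllP p d) L κ R → EllP p d → V) (hd : 2 ≤ d) (hκ1 : 1 < κ) (hκ2 : κ ≤ 2)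
    (hL : 0 < L) (hR : 0 < R) (hε : 0 < ε) (hO : IsLocalOracle (problemClass (EllP p d) L κ R) O)
    (hp : p < 2)
    (h1 : 1 ≤ rateBelowTwo ((1 / 30000) ^ 2) d L κ R ε)
    (hNd : rateBelowTwo ((1 / 30000) ^ 2) d L κ R ε ≤ d) :
    ENNReal.ofReal (rateBelowTwo ((1 / 30000) ^ 2) d L κ R ε) ≤
      (gradientComplexity (problemClass (EllP p d) L κ R) O ε : ℝ≥0∞) := by
  have hlog0 : 0 < Real.log d := by linarith [half_le_log hd]
  refine ofReal_le_gradientComplexity_of_hartley hd hp hκ1 hκ2 hL hR hε h1 hNd ?_ O hO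
  unfold rateBelowTwo
  have hX : 0 < L * R ^ (κ - 1) / (ε * Real.log d ^ (κ - 1)) := by positivity
  set X := L * R ^ (κ - 1) / (ε * Real.log d ^ (κ - 1))
  rw [Real.mul_rpow (by positivity) (by positivity), ← Real.rpow_mul hX.le,
    show 2 / (3 * κ - 2) * (κ * (1 / 2) + κ - 1) = 1 by
      have : 3 * κ - 2 ≠ 0 := by linarith
      field_simp
      ring, Real.rpow_one]
  -- The constant stands outside the power, and the inverse exponent may be as small as `1 / 2`.
  have hc : (((1 : ℝ) / 30000) ^ 2) ^ (κ * (1 / 2) + κ - 1) ≤ 1 / 30000 := by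
    rw [← Real.rpow_natCast, ← Real.rpow_mul (by norm_num)]
    calc _ ≤ ((1 : ℝ) / 30000) ^ (1 : ℝ) :=
          Real.rpow_le_rpow_of_exponent_ge (by norm_num) (by norm_num) (by push_cast; linarith)
      _ = _ := Real.rpow_one _
  nlinarith

theorem rateFinite_le {p : ℝ≥0∞} [Fact (1 ≤ p)] {d : ℕ} {κ L R ε : ℝ} {V : Type*}
    (O : problemClass (EllP p d) L κ R → EllP p d → V) (hd : 2 ≤ d) (hκ1 : 1 < κ) (hκ2 : κ ≤ 2)
    (hL : 0 < L) (hR : 0 < R) (hε : 0 < ε) (hO : IsLocalOracle (problemClass (EllP p d) L κ R) O)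
    (hp : 2 ≤ p) (hptop : p ≠ ∞)
    (h1 : 1 ≤ rateFinite ((1 / 30000) ^ 2) p.toReal d L κ R ε)
    (hNd : rateFinite ((1 / 30000) ^ 2) p.toReal d L κ R ε ≤ d) :
    ENNReal.ofReal (rateFinite ((1 / 30000) ^ 2) p.toReal d L κ R ε) ≤
      (gradientComplexity (problemClass (EllP p d) L κ R) O ε : ℝ≥0∞) := by
  have hp2 : 2 ≤ p.toReal := by
    have := ENNReal.toReal_mono hptop hp
    rwa [ENNReal.toReal_ofNat] at this
  have hq : 1 / 2 ≤ min p.toReal (Real.log d) := le_min (by linarith) (half_le_log hd)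
  have hq0 : 0 < min p.toReal (Real.log d) := by linarith
  refine ofReal_le_gradientComplexity_of_coordinates (q := min p.toReal (Real.log d)) hd hp ?_
    hκ1 hκ2 hL hR hε hq h1 hNd ?_ O hO
  · rcases le_total p.toReal (Real.log d) with h | h
    · exact Or.inl ⟨hptop, (min_eq_left h).ge⟩
    · exact Or.inr (min_eq_right h).ge
  unfold rateFinite
  have hX : 0 < L * R ^ (κ - 1) / (ε * min p.toReal (Real.log d) ^ (κ - 1)) := by positivity
  set X := L * R ^ (κ - 1) / (ε * min p.toReal (Real.log d) ^ (κ - 1))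
  rw [← Real.rpow_mul (by positivity),
    show p.toReal / (κ * p.toReal + κ - p.toReal) * (κ * (1 / p.toReal) + κ - 1) = 1 by
      have h1 : κ * p.toReal + κ - p.toReal ≠ 0 := by nlinarith
      have h2 : p.toReal ≠ 0 := by linarith
      rw [div_mul_eq_mul_div, div_eq_one_iff_eq h1]
      field_simp
      ring, Real.rpow_one]
  linarith

theorem rateInfinite_le {p : ℝ≥0∞} [Fact (1 ≤ p)] {d : ℕ} {κ L R ε : ℝ} {V : Type*}
    (O : problemClass (EllP p d) L κ R → EllP p d → V) (hd : 2 ≤ d) (hκ1 : 1 < κ) (hκ2 : κ ≤ 2)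
    (hL : 0 < L) (hR : 0 < R) (hε : 0 < ε) (hO : IsLocalOracle (problemClass (EllP p d) L κ R) O)
    (hp : p = ∞)
    (h1 : 1 ≤ rateInfinite ((1 / 30000) ^ 2) d L κ R ε)
    (hNd : rateInfinite ((1 / 30000) ^ 2) d L κ R ε ≤ d) :
    ENNReal.ofReal (rateInfinite ((1 / 30000) ^ 2) d L κ R ε) ≤
      (gradientComplexity (problemClass (EllP p d) L κ R) O ε : ℝ≥0∞) := by
  subst hp
  have hlog := half_le_log hd
  have hlog0 : 0 < Real.log d := by linarith
  refine ofReal_le_gradientComplexity_of_coordinates (q := Real.log d) hd le_top (Or.inr le_rfl)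
    hκ1 hκ2 hL hR hε hlog h1 hNd ?_ O hO
  unfold rateInfinite
  have hX : 0 < L * R ^ (κ - 1) / (ε * Real.log d ^ (κ - 1)) := by positivity
  set X := L * R ^ (κ - 1) / (ε * Real.log d ^ (κ - 1))
  -- In the exponent `p.toReal` is `0` for `p = ∞`, so that `1 / p.toReal` has the right value `0`.
  rw [← Real.rpow_mul (by positivity), ENNReal.toReal_top,
    show 1 / (κ - 1) * (κ * (1 / 0) + κ - 1) = 1 by
      have : κ - 1 ≠ 0 := by linarith
      rw [div_zero, mul_zero, zero_add, one_div_mul_cancel this], Real.rpow_one]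
  linarith

end Rates

end OracleComplexity

end

theorem mainTheorem4 :
    ∃ c : ℝ, 0 < c ∧
      ∀ (p : ℝ≥0∞) [Fact (1 ≤ p)] (d : ℕ) (κ L R ε : ℝ) (V : Type*)
        (O : OracleComplexity.problemClass (OracleComplexity.EllP p d) L κ R →
          OracleComplexity.EllP p d → V),
        2 ≤ d → 1 < κ → κ ≤ 2 → 0 < L → 0 < R → 0 < ε →
        OracleComplexity.IsLocalOracle
          (OracleComplexity.problemClass (OracleComplexity.EllP p d) L κ R) O →
        (p < 2 →
          1 ≤ OracleComplexity.rateBelowTwo c d L κ R ε →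
          OracleComplexity.rateBelowTwo c d L κ R ε ≤ d →
          ENNReal.ofReal (OracleComplexity.rateBelowTwo c d L κ R ε) ≤
            (OracleComplexity.gradientComplexity
              (OracleComplexity.problemClass (OracleComplexity.EllP p d) L κ R) O ε : ℝ≥0∞)) ∧
        (2 ≤ p → p ≠ ∞ →
          1 ≤ OracleComplexity.rateFinite c p.toReal d L κ R ε →
          OracleComplexity.rateFinite c p.toReal d L κ R ε ≤ d →
          ENNReal.ofReal (OracleComplexity.rateFinite c p.toReal d L κ R ε) ≤
            (OracleComplexity.gradientComplexity
              (OracleComplexity.problemClass (OracleComplexity.EllP p d) L κ R) O ε : ℝ≥0∞)) ∧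
        (p = ∞ →
          1 ≤ OracleComplexity.rateInfinite c d L κ R ε →
          OracleComplexity.rateInfinite c d L κ R ε ≤ d →
          ENNReal.ofReal (OracleComplexity.rateInfinite c d L κ R ε) ≤
            (OracleComplexity.gradientComplexity
              (OracleComplexity.problemClass (OracleComplexity.EllP p d) L κ R) O ε : ℝ≥0∞)) := by
  refine ⟨(1 / 30000) ^ 2, by norm_num, ?_⟩
  intro p _ d κ L R ε V O hd hκ1 hκ2 hL hR hε hO
  exact ⟨OracleComplexity.rateBelowTwo_le O hd hκ1 hκ2 hL hR hε hO,
    OracleComplexity.rateFinite_le O hd hκ1 hκ2 hL hR hε hO,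
    OracleComplexity.rateInfinite_le O hd hκ1 hκ2 hL hR hε hO⟩
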